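/- Let $\mathbb B$ be a separable real Banach space, partially ordered by a closed convex pointed cone $\mathcal K$ with nonempty interior: $x\le y$ iff $y-x\in\mathcal K$, $x<y$ iff $x\le y$ and $x\ne y$, and $x\ll y$ iff $y-x\in\operatorname{Int}\mathcal K$. Let $X\subseteq\mathbb B$ be a Borel set that is contained in the closure of its interior and is p-convex, i.e. $x,y\in X$, $x<y$ and $0<t<1$ imply $tx+(1-t)y\in X$. Let $\Phi:[0,\infty)\times X\to X$ be a (continuous) semiflow that is strongly order preserving: $x\le y$ implies $\Phi_t(x)\le\Phi_t(y)$ for all $t\ge 0$, and whenever $x<y$ in $X$ there are relatively open sets $U\ni x$ and $V\ni y$ in $X$ and $s\ge 0$ with $\Phi_s(u)\le\Phi_s(v)$ for all $u\in U$, $v\in V$. Fix $t_0\ge 0$ such that for every $t\ge t_0$ the map $\Phi_t:X\to X$ is compact (images of bounded subsets of $X$ have compact closure in $X$) and $C^1$: at each $x\in X$ it has a Fréchet derivative $\Phi_t'(x)$ relative to $X$, a compact linear operator on $\mathbb B$ depending continuously on $x\in X$ in the operator norm. (As the interior of $X$ is dense in $X$, these derivatives are uniquely determined.) Let $E$ be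 the set of equilibria, i.e. of $e\in X$ with $\Phi_t(e)=e$ for all $t\ge 0$, and let $\omega(x)\subseteq X$ be the omega limit set of $x$. Call $e\in E$ irreducible if for some $t>0$ with $t\ge t_0$ the operator $\Phi_t'(e)$ is strongly positive, i.e. $\Phi_t'(e)x\gg 0$ for all $x>0$. With $\rho$ denoting the spectral radius, put $$E_s=\{e\in E:\rho(\Phi_{t_0}'(e))\le 1\},\quad C=\{x\in X:\omega(x)=\{e\}\text{ for some }e\in E\},\quad C_s=\{x\in X:\omega(x)=\{e\}\text{ for some }e\in E_s\}.$$ Assume property (P): every subset of $E$ that is totally ordered by $\le$ contains at most countably many non-irreducible points. Then $C_s$ is prevalent in $C$, that is, $C\setminus C_s$ is shy: it is contained in a Borel set $S\subseteq\mathbb B$ for which there is a nonzero finite compactly supported Borel measure $\mu$ on $\mathbb B$ with $\mu(S+x)=0$ for every $x\in\mathbb B$. -/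

import Mathlib

open Set Filter Topology MeasureTheory

noncomputable section

/-- The strong ordering `x ≪ y` given by the order cone `Ici 0`: `y - x` is interior to it. -/
def ConeLT {E : Type*} [NormedAddCommGroup E] [PartialOrder E] (x y : E) : Prop :=
  y - x ∈ interior (Ici (0 : E))

/-- `X` contains the segment between any two of its points that are related by `<`. -/
def IsPConvex {E : Type*} [NormedAddCommGroup E] [NormedSpace ℝ E] [PartialOrder E]
    (X : Set E) : Prop :=
  ∀ x ∈ X, ∀ y ∈ X, x < y → ∀ t : ℝ, 0 < t → t < 1 → t • x + (1 - t) • y ∈ X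

/-- `Φ` restricts to a continuous semiflow on `X`; only times `t ≥ 0` and points of `X` matter. -/
structure IsSemiflowOn {E : Type*} [NormedAddCommGroup E] (X : Set E) (Φ : ℝ → E → E) :
    Prop where
  mapsTo : ∀ t : ℝ, 0 ≤ t → MapsTo (Φ t) X X
  continuousOn : ContinuousOn (fun p : ℝ × E => Φ p.1 p.2) (Ici (0 : ℝ) ×ˢ X)
  map_zero : ∀ x ∈ X, Φ 0 x = x
  map_add : ∀ t s : ℝ, 0 ≤ t → 0 ≤ s → ∀ x ∈ X, Φ (t + s) x = Φ t (Φ s x)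

/-- Strongly order preserving: monotone, and `x < y` forces `Φ s U ≤ Φ s V` for some `s ≥ 0` and
some neighbourhoods `U`, `V` of `x`, `y` (relative to `X`). -/
structure IsSOP {E : Type*} [NormedAddCommGroup E] [PartialOrder E] (X : Set E)
    (Φ : ℝ → E → E) : Prop where
  monotone : ∀ x ∈ X, ∀ y ∈ X, x ≤ y → ∀ t : ℝ, 0 ≤ t → Φ t x ≤ Φ t y
  strong : ∀ x ∈ X, ∀ y ∈ X, x < y → ∃ U V : Set E, IsOpen U ∧ IsOpen V ∧ x ∈ U ∧ y ∈ V ∧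
    ∃ s : ℝ, 0 ≤ s ∧ ∀ u ∈ U ∩ X, ∀ v ∈ V ∩ X, Φ s u ≤ Φ s v

/-- `f : X → X` is a compact map: the image of a bounded subset of `X` has compact closure in
`X`. -/
def IsCompactMapOn {E : Type*} [NormedAddCommGroup E] (X : Set E) (f : E → E) : Prop :=
  ∀ A ⊆ X, Bornology.IsBounded A → ∃ L ⊆ X, IsCompact L ∧ f '' A ⊆ L

/-- `D` is the Fréchet derivative of `f` on `X`, and it is continuous in the operator norm. If the
interior of `X` is dense in `X`, there is at most one such `D` on `X`. -/
structure HasC1DerivOn {E : Type*} [NormedAddCommGroup E] [NormedSpace ℝ E] (X : Set E)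
    (f : E → E) (D : E → E →L[ℝ] E) : Prop where
  hasFDerivWithinAt : ∀ x ∈ X, HasFDerivWithinAt f (D x) X x
  continuousOn : ContinuousOn D X

/-- The equilibria of the semiflow. -/
def equilibria {E : Type*} (X : Set E) (Φ : ℝ → E → E) : Set E :=
  {e | e ∈ X ∧ ∀ t : ℝ, 0 ≤ t → Φ t e = e}

/-- The omega limit set of `x`, taken in the space `X`. -/
def omegaSet {E : Type*} [TopologicalSpace E] (X : Set E) (Φ : ℝ → E → E) (x : E) : Set E :=
  omegaLimit atTop Φ {x} ∩ X

/-- A strongly positive operator maps `x > 0` to `A x ≫ 0`. -/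
def IsStronglyPositive {E : Type*} [NormedAddCommGroup E] [NormedSpace ℝ E] [PartialOrder E]
    (A : E →L[ℝ] E) : Prop :=
  ∀ x : E, 0 < x → ConeLT 0 (A x)

/-- The spectral radius `lim ‖A ^ n‖ ^ (1 / n)` of a bounded operator on a real Banach space (the
limit exists). It is the radius of the spectrum of the complexification of `A`; the real spectrum
used by `spectralRadius ℝ A` may be smaller. -/
def opSpectralRadius {E : Type*} [NormedAddCommGroup E] [NormedSpace ℝ E]
    (A : E →L[ℝ] E) : ℝ :=
  limsup (fun n : ℕ => ‖A ^ n‖ ^ (1 / (n : ℝ))) atTop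

/-- The equilibrium `e` is irreducible, where `D t e` stands for the derivative of `Φ t` at `e`
(`t ≥ t₀`). Strong positivity at some time persists at all later times, so restricting to `t ≥ t₀`
does not change the notion. -/
def IsIrreducibleAt {E : Type*} [NormedAddCommGroup E] [NormedSpace ℝ E] [PartialOrder E]
    (t₀ : ℝ) (D : ℝ → E → E →L[ℝ] E) (e : E) : Prop :=
  ∃ t : ℝ, 0 < t ∧ t₀ ≤ t ∧ IsStronglyPositive (D t e)

/-- Property (P): a totally ordered set of equilibria has at most countably many non-irreducible
points. -/
def PropertyP {E : Type*} [NormedAddCommGroup E] [NormedSpace ℝ E] [PartialOrder E]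
    (X : Set E) (Φ : ℝ → E → E) (t₀ : ℝ) (D : ℝ → E → E →L[ℝ] E) : Prop :=
  ∀ S ⊆ equilibria X Φ, IsChain (· ≤ ·) S → {e ∈ S | ¬ IsIrreducibleAt t₀ D e}.Countable

/-- The points of `X` whose omega limit set consists of one equilibrium. -/
def convergentPoints {E : Type*} [TopologicalSpace E] (X : Set E) (Φ : ℝ → E → E) : Set E :=
  {x | x ∈ X ∧ ∃ e ∈ equilibria X Φ, omegaSet X Φ x = {e}}

/-- The neutrally stable equilibria. -/
def stableEquilibria {E : Type*} [NormedAddCommGroup E] [NormedSpace ℝ E]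
    (X : Set E) (Φ : ℝ → E → E) (t₀ : ℝ) (D : ℝ → E → E →L[ℝ] E) : Set E :=
  {e | e ∈ equilibria X Φ ∧ opSpectralRadius (D t₀ e) ≤ 1}

/-- The points of `X` whose omega limit set consists of one neutrally stable equilibrium. -/
def stablyConvergentPoints {E : Type*} [NormedAddCommGroup E] [NormedSpace ℝ E]
    (X : Set E) (Φ : ℝ → E → E) (t₀ : ℝ) (D : ℝ → E → E →L[ℝ] E) : Set E :=
  {x | x ∈ X ∧ ∃ e ∈ stableEquilibria X Φ t₀ D, omegaSet X Φ x = {e}}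

/-- A set is shy if it lies in a Borel set all of whose translates are null for one nonzero, finite,
compactly supported Borel measure. -/
def IsShy {E : Type*} [NormedAddCommGroup E] [MeasurableSpace E] (W : Set E) : Prop :=
  ∃ S : Set E, W ⊆ S ∧ MeasurableSet S ∧
    ∃ μ : Measure E, IsFiniteMeasure μ ∧ μ ≠ 0 ∧ (∃ L : Set E, IsCompact L ∧ μ Lᶜ = 0) ∧
      ∀ x : E, μ ((fun w => w + x) '' S) = 0

/-- `W` is prevalent in `A` if `A \ W` is shy. -/
def IsPrevalentIn {E : Type*} [NormedAddCommGroup E] [MeasurableSpace E] (W A : Set E) : Prop :=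
  IsShy (A \ W)

end

/-!
The set to be shown shy lies in the set `S` of points of `X` whose orbit converges to an equilibrium
`e` with `ρ(D t₀ e) > 1`. It is Borel, because a limit of Borel functions is Borel, and the uniform
measure on a segment `[0, v]` with `v ≫ 0` witnesses that it is shy as soon as every line in the
direction `v` meets `S` in a countable set (`countable_line_inter_unstableBasin`). By monotonicity the
limits of the points of `S` on such a line form a chain of equilibria, and two facts give the claim.

*Few points of a line have the same limit* (`eq_of_coneLT_of_coneLT_of_tendsto`). Suppose
`a ≪ p ≪ b` converge to `e ≠ p`. A collapse of two of the orbits can only happen at `e`, so at a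
suitable late time the orbits are still strictly ordered while that of `p` has come close to `e`. By
the strong order preserving property the orbits issuing near `p` are then sandwiched between two
orbits converging to `e`, and compactness keeps them near `e` for all time. As the interior
of `X` is dense in `X`, two such orbits start at `y` and `y + ε k` with `k ≫ 0`. By the mean value
inequality their difference is a bounded orbit of a small perturbation of `D t₀ e`, which contradicts
`exists_forall_perturbed_orbit_unbounded`. Irreducibility is not needed for this step.

*The limits are countably many.* By property (P) only the irreducible ones matter, and these are
isolated in the chain (`eventually_not_comparable`): normalized differences accumulate at a positive
fixed vector of the derivatives, which is `≫ 0` by irreducibility, and a positive compact operator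
fixing an interior point of the cone has spectral radius at most one
(`opSpectralRadius_le_of_growth`).

The spectral theory is done over the reals and without the Krein–Rutman theorem. The cone is not
assumed normal; compactness is used in place of normality. The role of a spectral gap is played by a
rate `θ` that no full orbit of the operator realizes
(`IsCompactOperator.exists_rate_without_full_orbits`), which exists because vectors with
exponentially decaying backward orbits form a finite-dimensional space
(`IsCompactOperator.finiteDimensional_backwardSpace`).
-/

/-! ### Backward orbits of a compact operator -/

/-- The image of the ball of radius `2` under a compact operator contains no large `c`-separated
finite families. -/
lemma IsCompactOperator.exists_card_le_of_separated {E : Type*} [NormedAddCommGroup E]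
    [NormedSpace ℝ E] {A : E →L[ℝ] E} (hA : IsCompactOperator A) {c : ℝ} (hc : 0 < c) :
    ∃ N : ℕ, ∀ {ι : Type} (s : Finset ι) (y : ι → E), (∀ i ∈ s, ‖y i‖ ≤ 2) →
      (∀ i ∈ s, ∀ j ∈ s, i ≠ j → c ≤ dist (A (y i)) (A (y j))) → s.card ≤ N := by
  obtain ⟨K, hK, hAK⟩ := IsCompactOperator.image_closedBall_subset_compact (f := A.toLinearMap) hA 2
  obtain ⟨t, -, ht, hcov⟩ := Metric.finite_approx_of_totallyBounded hK.totallyBounded (c / 2)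
    (by positivity)
  refine ⟨ht.toFinset.card, fun {ι} s y hy hsep => ?_⟩
  have h : ∀ i ∈ s, ∃ z ∈ t, dist (A (y i)) z < c / 2 := by
    intro i hi
    have := hcov (hAK (mem_image_of_mem _ (by simpa using hy i hi : y i ∈ Metric.closedBall 0 2)))
    simpa using this
  choose! f hft hf using h
  refine Finset.card_le_card_of_injOn f (fun i hi => by simpa using hft i hi) ?_
  intro i hi j hj hij
  by_contra hne
  have h1 := hf i hi
  have h2 := hf j hj
  rw [← hij] at h2
  have := dist_triangle_right (A (y i)) (A (y j)) (f i)
  linarith [hsep i hi j hj hne]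

/-- Linearly independent vectors whose backward orbits under a compact operator tend to zero are
bounded in number: otherwise the operator expands the volume of a flag of large dimension at some
step, and by pigeonhole it does not contract many of the successive distances of the flag by more
than a fixed factor, which produces a large separated family in the image of a ball. -/
lemma IsCompactOperator.exists_card_le_of_backward_orbits {E : Type*} [NormedAddCommGroup E]
    [NormedSpace ℝ E] {A : E →L[ℝ] E} (hA : IsCompactOperator A) :
    ∃ N₀ : ℕ, ∀ (N : ℕ) (x : Fin N → ℕ → E), (∀ i m, A (x i (m + 1)) = x i m) →
      (∀ i, Tendsto (x i) atTop (𝓝 0)) → LinearIndependent ℝ (fun i => x i 0) → N ≤ N₀ := by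
  set M : ℝ := ‖A‖ + 1 with hM
  have hM1 : 1 ≤ M := by simp [hM]
  have hM0 : 0 < M := by linarith
  set c : ℝ := 1 / (2 * M) with hc
  have hc0 : 0 < c := by positivity
  obtain ⟨N₁, hN₁⟩ := hA.exists_card_le_of_separated hc0
  refine ⟨2 * N₁, fun N x hx hlim hind => ?_⟩
  rcases Nat.eq_zero_or_pos N with rfl | hN
  · simp
  -- `W i m` is the `i`-th step of the flag at time `-m`.
  let W : Fin N → ℕ → Submodule ℝ E := fun i m => Submodule.span ℝ ((fun j => x j m) '' {j | j < i})
  have hAW : ∀ i m w, w ∈ W i (m + 1) → A w ∈ W i m := by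
    intro i m w hw
    have : W i (m + 1) ≤ (W i m).comap A.toLinearMap := by
      refine Submodule.span_le.2 ?_
      rintro _ ⟨j, hj, rfl⟩
      have : A (x j (m + 1)) ∈ W i m := by
        rw [hx]; exact Submodule.subset_span ⟨j, hj, rfl⟩
      exact this
    exact this hw
  have hWne : ∀ i m, (W i m : Set E).Nonempty := fun i m => ⟨0, (W i m).zero_mem⟩
  let d : Fin N → ℕ → ℝ := fun i m => Metric.infDist (x i m) (W i m)
  have hd_le : ∀ i m, d i m ≤ M * d i (m + 1) := by
    intro i m
    rw [← div_le_iff₀' hM0]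
    refine (Metric.le_infDist (hWne i (m + 1))).2 fun w hw => ?_
    rw [div_le_iff₀' hM0]
    calc d i m ≤ dist (x i m) (A w) := Metric.infDist_le_dist_of_mem (hAW i m w hw)
      _ = ‖A (x i (m + 1) - w)‖ := by rw [map_sub, hx, dist_eq_norm]
      _ ≤ ‖A‖ * ‖x i (m + 1) - w‖ := A.le_opNorm _
      _ ≤ M * dist (x i (m + 1)) w := by rw [dist_eq_norm]; gcongr; simp [hM]
  have hd0 : ∀ i m, 0 < d i m := by
    intro i m
    induction m with
    | zero =>
      have : FiniteDimensional ℝ (W i 0) :=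
        FiniteDimensional.span_of_finite ℝ ((Set.toFinite _).image _)
      refine ((W i 0).closed_of_finiteDimensional.notMem_iff_infDist_pos (hWne i 0)).1 ?_
      exact hind.notMem_span_image (by simp)
    | succ m ih =>
      have := hd_le i m
      by_contra h
      nlinarith
  have hdlim : ∀ i, Tendsto (d i) atTop (𝓝 0) := by
    intro i
    refine squeeze_zero (fun m => (hd0 i m).le) (fun m => ?_)
      (tendsto_zero_iff_norm_tendsto_zero.1 (hlim i))
    simpa [dist_eq_norm] using Metric.infDist_le_dist_of_mem (x := x i m) (W i m).zero_mem
  -- The volume `∏ i, d i m` tends to zero, so it does not increase with `m` at some step.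
  obtain ⟨m, hm⟩ : ∃ m, ∏ i, d i (m + 1) ≤ ∏ i, d i m := by
    by_contra! hcon
    have hmono : StrictMono fun m => ∏ i, d i m := strictMono_nat_of_lt_succ hcon
    have hl : Tendsto (fun m => ∏ i, d i m) atTop (𝓝 0) := by
      have := tendsto_finsetProd (Finset.univ : Finset (Fin N)) fun i _ => hdlim i
      rwa [Finset.prod_const, zero_pow (by simp; omega)] at this
    have h1 := hmono.monotone.ge_of_tendsto hl 0
    have h2 : 0 < ∏ i, d i 0 := Finset.prod_pos fun i _ => hd0 i 0
    exact absurd h1 (not_le.2 h2)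
  let r : Fin N → ℝ := fun i => d i m / d i (m + 1)
  have hr0 : ∀ i, 0 < r i := fun i => div_pos (hd0 i m) (hd0 i _)
  have hrM : ∀ i, r i ≤ M := fun i => (div_le_iff₀ (hd0 i _)).2 (hd_le i m)
  have hprod : 1 ≤ ∏ i, r i := by
    simp only [r, Finset.prod_div_distrib]
    rwa [one_le_div (Finset.prod_pos fun i _ => hd0 i _)]
  let G : Finset (Fin N) := Finset.univ.filter fun i => c ≤ r i
  have hG : G.card ≤ N₁ := by
    have hy : ∀ i, ∃ w ∈ W i (m + 1), dist (x i (m + 1)) w < 2 * d i (m + 1) := fun i =>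
      (Metric.infDist_lt_iff (hWne i (m + 1))).1 (by
        have := hd0 i (m + 1)
        change d i (m + 1) < _
        linarith)
    choose w hwW hw using hy
    let y : Fin N → E := fun i => (d i (m + 1))⁻¹ • (x i (m + 1) - w i)
    have hAy : ∀ i, A (y i) = (d i (m + 1))⁻¹ • (x i m - A (w i)) := by
      intro i; simp only [y, map_smul, map_sub, hx]
    have hsep : ∀ i ∈ G, ∀ z ∈ W i m, c ≤ dist (A (y i)) z := by
      intro i hi z hz
      have hi' : c ≤ r i := (Finset.mem_filter.1 hi).2
      have hdp := hd0 i (m + 1)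
      have : d i m ≤ dist (x i m) (A (w i) + d i (m + 1) • z) :=
        Metric.infDist_le_dist_of_mem
          ((W i m).add_mem (hAW i m _ (hwW i)) ((W i m).smul_mem _ hz))
      refine hi'.trans ?_
      rw [div_le_iff₀ hdp, hAy]
      refine this.trans (le_of_eq ?_)
      rw [dist_eq_norm, dist_eq_norm]
      have e : x i m - (A (w i) + d i (m + 1) • z)
          = d i (m + 1) • ((d i (m + 1))⁻¹ • (x i m - A (w i)) - z) := by
        rw [smul_sub, smul_smul, mul_inv_cancel₀ hdp.ne', one_smul]; abel
      rw [e, norm_smul, Real.norm_of_nonneg hdp.le, mul_comm]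
    have hmem : ∀ i j, j < i → A (y j) ∈ W i m := by
      intro i j hji
      rw [hAy]
      refine (W i m).smul_mem _ ((W i m).sub_mem (Submodule.subset_span ⟨j, hji, rfl⟩) ?_)
      refine Submodule.span_mono (image_mono ?_) (hAW j m _ (hwW j))
      intro l hl
      exact lt_trans (show l < j from hl) hji
    refine hN₁ G y (fun i _ => ?_) fun i hi j hj hij => ?_
    · have hdp := hd0 i (m + 1)
      simp only [y]
      rw [norm_smul, norm_inv, Real.norm_of_nonneg hdp.le, ← dist_eq_norm, inv_mul_le_iff₀ hdp]
      linarith [hw i]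
    · rcases lt_or_gt_of_ne hij with h | h
      · rw [dist_comm]; exact hsep j hj _ (hmem j i h)
      · exact hsep i hi _ (hmem i j h)
  by_contra! hlt
  have hcard : (Finset.univ.filter fun i => ¬ c ≤ r i).card = N - G.card := by
    have := Finset.card_filter_add_card_filter_not (s := (Finset.univ : Finset (Fin N)))
      (fun i => c ≤ r i)
    simp only [Finset.card_univ, Fintype.card_fin] at this
    simp only [G]; omega
  have h1 : ∏ i, r i ≤ M ^ G.card * c ^ (N - G.card) := by
    rw [← Finset.prod_filter_mul_prod_filter_not Finset.univ (fun i => c ≤ r i), ← hcard]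
    rw [← Finset.prod_const, ← Finset.prod_const]
    refine mul_le_mul (Finset.prod_le_prod (fun i _ => (hr0 i).le) fun i _ => hrM i)
      (Finset.prod_le_prod (fun i _ => (hr0 i).le) fun i hi => ?_)
      (Finset.prod_nonneg fun i _ => (hr0 i).le) (Finset.prod_nonneg fun i _ => hM0.le)
    exact (not_le.1 (Finset.mem_filter.1 hi).2).le
  have h2 : M ^ G.card * c ^ (N - G.card) ≤ (M * c) ^ (N - G.card) := by
    rw [mul_pow]
    exact mul_le_mul_of_nonneg_right (pow_le_pow_right₀ hM1 (by omega)) (by positivity)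
  have h3 : M * c = 1 / 2 := by rw [hc]; field_simp
  have h4 : (M * c) ^ (N - G.card) < 1 := by
    rw [h3]; exact pow_lt_one₀ (by norm_num) (by norm_num) (by omega)
  linarith

/-- The vectors having a backward orbit under `A` that decays at least like `θ ^ (-m)`. -/
def backwardSpace {E : Type*} [NormedAddCommGroup E] [NormedSpace ℝ E] (A : E →L[ℝ] E) (θ : ℝ) :
    Submodule ℝ E where
  carrier := {x | ∃ s : ℕ → E, s 0 = x ∧ (∀ m, A (s (m + 1)) = s m) ∧
    ∃ C : ℝ, ∀ m, |θ| ^ m * ‖s m‖ ≤ C}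
  add_mem' := by
    rintro x y ⟨s, hs0, hs, C, hC⟩ ⟨s', hs0', hs', C', hC'⟩
    refine ⟨s + s', by simp [hs0, hs0'], fun m => by simp [hs, hs'], C + C', fun m => ?_⟩
    calc |θ| ^ m * ‖(s + s') m‖ ≤ |θ| ^ m * (‖s m‖ + ‖s' m‖) := by
          gcongr; exact norm_add_le _ _
      _ ≤ C + C' := by rw [mul_add]; exact add_le_add (hC m) (hC' m)
  zero_mem' := ⟨0, rfl, fun m => by simp, 0, fun m => by simp⟩
  smul_mem' := by
    rintro a x ⟨s, hs0, hs, C, hC⟩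
    refine ⟨a • s, by simp [hs0], fun m => by simp [hs], |a| * C, fun m => ?_⟩
    rw [Pi.smul_apply, norm_smul, Real.norm_eq_abs, mul_left_comm]
    exact mul_le_mul_of_nonneg_left (hC m) (abs_nonneg a)

section

variable {E : Type*} [NormedAddCommGroup E] [NormedSpace ℝ E] {A : E →L[ℝ] E}

lemma backwardSpace_anti {θ θ' : ℝ} (h0 : 0 ≤ θ) (h : θ ≤ θ') :
    backwardSpace A θ' ≤ backwardSpace A θ := by
  rintro x ⟨s, hs0, hs, C, hC⟩
  refine ⟨s, hs0, hs, C, fun m => le_trans ?_ (hC m)⟩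
  rw [abs_of_nonneg h0, abs_of_nonneg (h0.trans h)]
  gcongr

lemma map_mem_backwardSpace {θ : ℝ} {x : E} (hx : x ∈ backwardSpace A θ) :
    A x ∈ backwardSpace A θ := by
  obtain ⟨s, hs0, hs, C, hC⟩ := hx
  refine ⟨fun m => A (s m), by simp [hs0], fun m => by simp [hs], ‖A‖ * C, fun m => ?_⟩
  calc |θ| ^ m * ‖A (s m)‖ ≤ |θ| ^ m * (‖A‖ * ‖s m‖) := by gcongr; exact A.le_opNorm _
    _ = ‖A‖ * (|θ| ^ m * ‖s m‖) := by ring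
    _ ≤ ‖A‖ * C := by gcongr; exact hC m

lemma exists_map_eq_of_mem_backwardSpace {θ : ℝ} (hθ : 0 < θ) {x : E}
    (hx : x ∈ backwardSpace A θ) : ∃ y ∈ backwardSpace A θ, A y = x := by
  obtain ⟨s, hs0, hs, C, hC⟩ := hx
  refine ⟨s 1, ⟨fun m => s (m + 1), rfl, fun m => hs _, C / θ, fun m => ?_⟩, by rw [hs, hs0]⟩
  have := hC (m + 1)
  rw [abs_of_pos hθ] at this ⊢
  rw [le_div_iff₀ hθ]
  calc θ ^ m * ‖s (m + 1)‖ * θ = θ ^ (m + 1) * ‖s (m + 1)‖ := by ring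
    _ ≤ C := this

lemma IsCompactOperator.finiteDimensional_backwardSpace (hA : IsCompactOperator A) {θ : ℝ}
    (hθ : 1 < θ) : FiniteDimensional ℝ (backwardSpace A θ) := by
  obtain ⟨N₀, hN₀⟩ := hA.exists_card_le_of_backward_orbits
  have hrank : Module.rank ℝ (backwardSpace A θ) ≤ N₀ := by
    refine rank_le fun t ht => ?_
    have hmem : ∀ i : Fin t.card, ((t.equivFin.symm i : backwardSpace A θ) : E) ∈
        backwardSpace A θ := fun i => Subtype.property _
    choose s hs0 hs C hC using hmem
    refine hN₀ t.card s hs (fun i => ?_) ?_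
    · have hlim : Tendsto (fun m : ℕ => C i * (θ⁻¹) ^ m) atTop (𝓝 0) := by
        simpa using (tendsto_pow_atTop_nhds_zero_of_lt_one (by positivity)
          (inv_lt_one_of_one_lt₀ hθ)).const_mul (C i)
      refine squeeze_zero_norm (fun m => ?_) hlim
      have := hC i m
      rw [abs_of_pos (by linarith)] at this
      rw [inv_pow, ← div_eq_mul_inv, le_div_iff₀ (by positivity), mul_comm]
      exact this
    · simp only [hs0]
      exact (ht.map' (backwardSpace A θ).subtype (Submodule.ker_subtype _)).comp _
        t.equivFin.symm.injective
  exact Module.rank_lt_aleph0_iff.1 (hrank.trans_lt (Cardinal.natCast_lt_aleph0))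

/-- For a suitable `θ` in any interval `(1, ρ)`, a compact operator has no nonzero full orbit bounded
by a multiple of `θ ^ n` for positive and negative `n`. This replaces a spectral gap: such an orbit
makes the dimension of `backwardSpace A θ` jump at `θ`, and the dimension is an integer that decreases
with `θ`. -/
lemma IsCompactOperator.exists_rate_without_full_orbits (hA : IsCompactOperator A) {ρ : ℝ}
    (hρ : 1 < ρ) : ∃ θ, 1 < θ ∧ θ < ρ ∧ ∀ (u : ℤ → E) (C : ℝ), (∀ n, u (n + 1) = A (u n)) →
      (∀ n, ‖u n‖ ≤ C * θ ^ n) → u 0 = 0 := by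
  let f : Ioo 1 ρ → ℕ := fun θ => Module.finrank ℝ (backwardSpace A θ)
  have : Nonempty (Ioo 1 ρ) := (nonempty_Ioo.2 hρ).to_subtype
  -- The dimension is smallest at `θ₁`, hence constant from there to `ρ`.
  obtain ⟨⟨θ₁, h1, h1'⟩, hmin⟩ : ∃ θ₁, ∀ θ, f θ₁ ≤ f θ :=
    ⟨Function.argmin f, fun θ => Function.argmin_le f θ⟩
  obtain ⟨θ, hθ1, hθρ⟩ := exists_between h1'
  obtain ⟨θ₂, hθθ₂, hθ₂ρ⟩ := exists_between hθρ
  have hθ0 : 0 < θ := by linarith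
  have hθ₂0 : 0 < θ₂ := by linarith
  refine ⟨θ, h1.trans hθ1, hθρ, fun u C hu hC => ?_⟩
  set Y := backwardSpace A θ₂ with hY
  have : FiniteDimensional ℝ (backwardSpace A θ₁) := hA.finiteDimensional_backwardSpace h1
  have : FiniteDimensional ℝ Y := hA.finiteDimensional_backwardSpace (by linarith)
  have hYeq : Y = backwardSpace A θ₁ := by
    refine Submodule.eq_of_le_of_finrank_le (backwardSpace_anti (by linarith) (by linarith)) ?_
    exact hmin ⟨θ₂, by linarith, hθ₂ρ⟩
  have huY : ∀ n, u n ∈ Y := by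
    intro n
    rw [hYeq]
    refine backwardSpace_anti (by linarith) hθ1.le ⟨fun m => u (n - m), by simp, fun m => ?_,
      C * θ ^ n, fun m => ?_⟩
    · rw [← hu]; congr 1; push_cast; ring
    · rw [abs_of_pos hθ0]
      calc θ ^ m * ‖u (n - m)‖ ≤ θ ^ m * (C * θ ^ (n - m : ℤ)) := by gcongr; exact hC _
        _ = C * θ ^ n := by rw [zpow_sub₀ hθ0.ne', zpow_natCast]; field_simp
  -- `A` is invertible on the finite-dimensional space `Y`, with inverse `B`.
  let T : Y →ₗ[ℝ] Y := A.toLinearMap.restrict fun x hx => map_mem_backwardSpace hx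
  have hT : ∀ y : Y, ((T y : Y) : E) = A y := fun y => rfl
  have hTsurj : Function.Surjective T := by
    rintro ⟨x, hx⟩
    obtain ⟨y, hy, hyx⟩ := exists_map_eq_of_mem_backwardSpace hθ₂0 hx
    exact ⟨⟨y, hy⟩, Subtype.ext hyx⟩
  have hTinj : Function.Injective T := LinearMap.injective_iff_surjective.2 hTsurj
  let B : Y →L[ℝ] Y := LinearMap.toContinuousLinearMap
    (LinearEquiv.ofBijective T ⟨hTinj, hTsurj⟩).symm.toLinearMap
  have hBT : ∀ y, B (T y) = y := fun y =>
    (LinearEquiv.ofBijective T ⟨hTinj, hTsurj⟩).symm_apply_apply y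
  have hbound : ∀ y : Y, ∃ K, ∀ m : ℕ, ‖(θ₂ ^ m • B ^ m) y‖ ≤ K := by
    rintro ⟨x, s, hs0, hs, K, hK⟩
    have hsY : ∀ m, s m ∈ Y := by
      intro m
      refine ⟨fun j => s (m + j), by simp, fun j => hs _, K / θ₂ ^ m, fun j => ?_⟩
      have := hK (m + j)
      rw [abs_of_pos hθ₂0] at this ⊢
      rw [le_div_iff₀ (by positivity)]
      calc θ₂ ^ j * ‖s (m + j)‖ * θ₂ ^ m = θ₂ ^ (m + j) * ‖s (m + j)‖ := by ring
        _ ≤ K := this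
    have hBm : ∀ m, (B ^ m) ⟨x, s, hs0, hs, K, hK⟩ = ⟨s m, hsY m⟩ := by
      intro m
      induction m with
      | zero => exact Subtype.ext hs0.symm
      | succ m ih =>
        have e : (⟨s m, hsY m⟩ : Y) = T ⟨s (m + 1), hsY (m + 1)⟩ := Subtype.ext (hs m).symm
        rw [pow_succ', mul_apply_eq_comp, ih, e, hBT]
    refine ⟨K, fun m => ?_⟩
    have := hK m
    rw [smul_apply, hBm, norm_smul, norm_pow, Real.norm_eq_abs]
    exact this
  have : CompleteSpace Y := FiniteDimensional.complete ℝ Y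
  obtain ⟨K, hK⟩ := banach_steinhaus hbound
  have hback : ∀ m : ℕ, (B ^ m) ⟨u m, huY m⟩ = ⟨u 0, huY 0⟩ := by
    intro m
    induction m with
    | zero => rfl
    | succ m ih =>
      have e : (⟨u (m + 1 : ℕ), huY _⟩ : Y) = T ⟨u m, huY m⟩ := Subtype.ext (by
        rw [hT]; push_cast; exact hu m)
      rw [pow_succ, mul_apply_eq_comp, e, hBT, ih]
  have hest : ∀ m : ℕ, ‖u 0‖ ≤ K * C * (θ / θ₂) ^ m := by
    intro m
    have h := (θ₂ ^ m • B ^ m).le_of_opNorm_le (hK m) ⟨u m, huY m⟩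
    rw [smul_apply, hback, norm_smul, norm_pow, Real.norm_of_nonneg hθ₂0.le] at h
    have hK0 : 0 ≤ K := (norm_nonneg _).trans (hK 0)
    have h2 : θ₂ ^ m * ‖u 0‖ ≤ K * (C * θ ^ m) := h.trans (by
      gcongr
      simpa using hC m)
    rw [div_pow, ← mul_div_assoc, le_div_iff₀ (by positivity)]
    linarith
  have hlim : Tendsto (fun m : ℕ => K * C * (θ / θ₂) ^ m) atTop (𝓝 0) := by
    simpa using (tendsto_pow_atTop_nhds_zero_of_lt_one (by positivity)
      ((div_lt_one hθ₂0).2 hθθ₂)).const_mul (K * C)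
  exact norm_le_zero_iff.1 (ge_of_tendsto' hlim hest)

end

/-! ### Positive compact operators and orbits of interior points of the cone -/

lemma pow_apply_nonneg {E : Type*} [NormedAddCommGroup E] [NormedSpace ℝ E] [PartialOrder E]
    {A : E →L[ℝ] E} (hpos : ∀ x, 0 ≤ x → 0 ≤ A x) (n : ℕ) {x : E}
    (hx : 0 ≤ x) : 0 ≤ (A ^ n) x := by
  induction n with
  | zero => simpa
  | succ n ih => rw [pow_succ', mul_apply_eq_comp]; exact hpos _ ih

section

variable {E : Type*} [NormedAddCommGroup E] [NormedSpace ℝ E] [PartialOrder E]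
  [IsOrderedAddMonoid E] [PosSMulMono ℝ E]

/-- An interior point of the cone is an order unit that dominates the norm. -/
lemma exists_order_unit_bound {k : E} (hk : k ∈ interior (Ici (0 : E))) :
    ∃ c : ℝ, 0 < c ∧ ∀ x : E, -((c * ‖x‖) • k) ≤ x ∧ x ≤ (c * ‖x‖) • k := by
  obtain ⟨r, hr, hball⟩ := Metric.mem_nhds_iff.1 (mem_interior_iff_mem_nhds.1 hk)
  have key : ∀ x : E, x ≤ (2 / r * ‖x‖) • k := by
    intro x
    rcases eq_or_ne x 0 with rfl | hx
    · simp
    have hx0 : 0 < ‖x‖ := norm_pos_iff.2 hx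
    have h1 : k - (r / (2 * ‖x‖)) • x ∈ Metric.ball k r := by
      rw [mem_ball_iff_norm, sub_sub_cancel_left, norm_neg, norm_smul,
        Real.norm_of_nonneg (by positivity)]
      have : r / (2 * ‖x‖) * ‖x‖ = r / 2 := by field_simp
      rw [this]; linarith
    have h2 : (r / (2 * ‖x‖)) • x ≤ k := sub_nonneg.1 (hball h1)
    have h3 := smul_le_smul_of_nonneg_left h2 (by positivity : 0 ≤ 2 / r * ‖x‖)
    rw [smul_smul] at h3
    have h4 : 2 / r * ‖x‖ * (r / (2 * ‖x‖)) = 1 := by field_simp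
    rwa [h4, one_smul] at h3
  refine ⟨2 / r, by positivity, fun x => ⟨?_, key x⟩⟩
  have := key (-x)
  rw [norm_neg] at this
  exact neg_le.1 this

/-- The spectral radius of a positive compact operator is at most the growth rate of the orbit of
one interior point of the cone. No normality of the cone is needed: for `n` with `‖A ^ n‖ / θ ^ n`
larger than all its predecessors, the vectors `A ^ n x / ‖A ^ n‖` of norm about one lie in a compact
set, while they are squeezed between vectors tending to zero. -/
lemma opSpectralRadius_le_of_growth [OrderClosedTopology E] {A : E →L[ℝ] E}
    (hA : IsCompactOperator A) (hpos : ∀ x, 0 ≤ x → 0 ≤ A x) {k : E}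
    (hk : k ∈ interior (Ici (0 : E))) {θ C : ℝ} (hθ : 1 ≤ θ)
    (hgrowth : ∀ n : ℕ, ‖(A ^ n) k‖ ≤ C * θ ^ n) : opSpectralRadius A ≤ θ := by
  by_contra! hlt
  obtain ⟨θ', hθθ', hθ'⟩ := exists_between hlt
  have hθ0 : 0 < θ := by linarith
  have hC0 : 0 ≤ C := by simpa using (norm_nonneg _).trans (hgrowth 0)
  have hfreq : ∃ᶠ n : ℕ in atTop, θ' < ‖A ^ n‖ ^ (1 / (n : ℝ)) := by
    refine frequently_lt_of_lt_limsup ?_ hθ'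
    exact IsBoundedUnder.isCoboundedUnder_le
      ⟨0, eventually_map.2 (Eventually.of_forall fun n => by positivity)⟩
  let a : ℕ → ℝ := fun n => ‖A ^ n‖ / θ ^ n
  have hunb : ∀ b : ℝ, ∃ n, b < a n := by
    intro b
    have h1 : Tendsto (fun n : ℕ => (θ' / θ) ^ n) atTop atTop :=
      tendsto_pow_atTop_atTop_of_one_lt ((one_lt_div hθ0).2 hθθ')
    obtain ⟨n, hn, hb, hn0⟩ := (hfreq.and_eventually
      ((h1.eventually_gt_atTop b).and (eventually_ne_atTop 0))).exists
    refine ⟨n, hb.trans ?_⟩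
    rw [div_pow]
    refine div_lt_div_of_pos_right ?_ (by positivity)
    calc θ' ^ n < (‖A ^ n‖ ^ (1 / (n : ℝ))) ^ n := pow_lt_pow_left₀ hn (by linarith) hn0
      _ = ‖A ^ n‖ := by rw [one_div, Real.rpow_inv_natCast_pow (norm_nonneg _) hn0]
  have hrec : ∀ b : ℝ, ∃ n, b < a (n + 1) ∧ a n ≤ a (n + 1) := by
    intro b
    classical
    have hex := hunb (max b (a 0))
    obtain ⟨m, hm⟩ : ∃ m, Nat.find hex = m + 1 := by
      refine Nat.exists_eq_succ_of_ne_zero fun h0 => ?_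
      have := Nat.find_spec hex
      rw [h0] at this
      exact absurd this (not_lt.2 (le_max_right _ _))
    have hs := Nat.find_spec hex
    rw [hm] at hs
    have hmin := Nat.find_min hex (m := m) (by omega)
    exact ⟨m, (le_max_left _ _).trans_lt hs, (not_lt.1 hmin).trans hs.le⟩
  obtain ⟨c, hc0, hc⟩ := exists_order_unit_bound hk
  have hy : ∀ j : ℕ, ∃ z b : E, ‖z‖ ≤ 1 ∧ 1 / 2 ≤ ‖A z‖ ∧ -b ≤ A z ∧ A z ≤ b ∧
      ‖b‖ ≤ c * C * (1 / ((j : ℝ) + 1)) := by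
    intro j
    obtain ⟨n, hn, hn'⟩ := hrec (j + 1)
    have ha : 0 < a (n + 1) := lt_trans (by positivity) hn
    have hnorm : 0 < ‖A ^ (n + 1)‖ := by
      by_contra h
      have h' : ‖A ^ (n + 1)‖ = 0 := le_antisymm (not_lt.1 h) (norm_nonneg _)
      simp [a, h'] at ha
    obtain ⟨x, hx1, hx⟩ := (A ^ (n + 1)).exists_lt_apply_of_lt_opNorm
      (half_lt_self hnorm)
    have hAz : A (‖A ^ (n + 1)‖⁻¹ • (A ^ n) x) = ‖A ^ (n + 1)‖⁻¹ • (A ^ (n + 1)) x := by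
      rw [map_smul, pow_succ', mul_apply_eq_comp]
    refine ⟨‖A ^ (n + 1)‖⁻¹ • (A ^ n) x, (‖A ^ (n + 1)‖⁻¹ * (c * ‖x‖)) • (A ^ (n + 1)) k,
      ?_, ?_, ?_, ?_, ?_⟩
    · rw [norm_smul, norm_inv, norm_norm, inv_mul_le_iff₀ hnorm, mul_one]
      have h1 : ‖A ^ n‖ ≤ ‖A ^ (n + 1)‖ := by
        simp only [a] at hn'
        rw [div_le_div_iff₀ (by positivity) (by positivity), pow_succ] at hn'
        have h2 : ‖A ^ n‖ * θ ≤ ‖A ^ (n + 1)‖ := by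
          refine le_of_mul_le_mul_right ?_ (by positivity : 0 < θ ^ n)
          linarith
        nlinarith [norm_nonneg (A ^ n)]
      calc ‖(A ^ n) x‖ ≤ ‖A ^ n‖ * ‖x‖ := (A ^ n).le_opNorm x
        _ ≤ ‖A ^ n‖ * 1 := by gcongr
        _ ≤ ‖A ^ (n + 1)‖ := by rwa [mul_one]
    · rw [hAz, norm_smul, norm_inv, norm_norm, le_inv_mul_iff₀ hnorm]
      linarith
    · have h1 := pow_apply_nonneg hpos (n + 1) (sub_nonneg.2 (hc x).1)
      rw [hAz, mul_smul, ← smul_neg]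
      refine smul_le_smul_of_nonneg_left ?_ (by positivity)
      rw [map_sub, map_neg, map_smul] at h1
      exact sub_nonneg.1 h1
    · have h1 := pow_apply_nonneg hpos (n + 1) (sub_nonneg.2 (hc x).2)
      rw [hAz, mul_smul]
      refine smul_le_smul_of_nonneg_left ?_ (by positivity)
      rw [map_sub, map_smul] at h1
      exact sub_nonneg.1 h1
    · rw [norm_smul, Real.norm_of_nonneg (by positivity)]
      have h1 : ‖A ^ (n + 1)‖ = a (n + 1) * θ ^ (n + 1) := by simp only [a]; field_simp
      calc ‖A ^ (n + 1)‖⁻¹ * (c * ‖x‖) * ‖(A ^ (n + 1)) k‖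
          ≤ ‖A ^ (n + 1)‖⁻¹ * (c * 1) * (C * θ ^ (n + 1)) := by
            gcongr
            exact hgrowth _
        _ = c * C * (1 / a (n + 1)) := by rw [h1]; field_simp
        _ ≤ c * C * (1 / ((j : ℝ) + 1)) := by gcongr
  choose z b hz hAz hbz hzb hb using hy
  have hb0 : Tendsto b atTop (𝓝 0) := by
    refine squeeze_zero_norm hb ?_
    simpa using (tendsto_one_div_add_atTop_nhds_zero_nat (𝕜 := ℝ)).const_mul (c * C)
  obtain ⟨K, hK, hAK⟩ :=
    IsCompactOperator.image_closedBall_subset_compact (f := A.toLinearMap) hA 1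
  obtain ⟨y, -, φ, hφ, hlim⟩ := hK.tendsto_subseq fun j =>
    hAK (mem_image_of_mem _ (by simpa using hz j : z j ∈ Metric.closedBall 0 1))
  have hbφ := hb0.comp hφ.tendsto_atTop
  have h1 : y ≤ 0 := le_of_tendsto_of_tendsto' hlim hbφ fun j => hzb _
  have h2 : 0 ≤ y := by
    have := hbφ.neg
    rw [neg_zero] at this
    exact le_of_tendsto_of_tendsto' this hlim fun j => hbz _
  have h3 : 1 / 2 ≤ ‖y‖ := ge_of_tendsto' hlim.norm fun j => hAz _
  rw [le_antisymm h1 h2, norm_zero] at h3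
  norm_num at h3

lemma exists_forall_le_of_tendsto_zero {w : ℕ → ℝ} (h0 : 0 < w 0) (hw : Tendsto w atTop (𝓝 0)) :
    ∃ n, ∀ m, w m ≤ w n := by
  obtain ⟨N, hN⟩ := eventually_atTop.1 (hw.eventually_lt_const h0)
  obtain ⟨n, -, hn⟩ := (Finset.range (N + 1)).exists_max_image w ⟨0, by simp⟩
  refine ⟨n, fun m => ?_⟩
  rcases le_or_gt N m with h | h
  · exact (hN m h).le.trans (hn 0 (by simp))
  · exact hn m (by simp; omega)

/-- Linear instability persists under small perturbations: if `ρ(A) > 1`, a perturbed orbit of `A`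
issuing from an interior point of the cone is unbounded. Otherwise choose a rate `θ` that no full
orbit of `A` realizes, and the time `n` at which `θ ^ (-n) ‖Δ n‖` is largest. As the perturbation
vanishes, either `n` stays bounded, and the orbit of `k` grows at most like `θ ^ n`, or the orbits
recentred at time `n` converge to a full orbit of `A` with the forbidden rate. -/
lemma exists_forall_perturbed_orbit_unbounded [OrderClosedTopology E] {A : E →L[ℝ] E}
    (hA : IsCompactOperator A) (hpos : ∀ x, 0 ≤ x → 0 ≤ A x) {k : E}
    (hk : k ∈ interior (Ici (0 : E))) (hρ : 1 < opSpectralRadius A) :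
    ∃ η : ℝ, 0 < η ∧ ∀ (Δ : ℕ → E) (R : ℝ), Δ 0 = k →
      (∀ n, ‖Δ (n + 1) - A (Δ n)‖ ≤ η * ‖Δ n‖) → ∃ n, R < ‖Δ n‖ := by
  obtain ⟨θ, hθ1, hθρ, hθ⟩ := hA.exists_rate_without_full_orbits hρ
  have hθ0 : 0 < θ := by linarith
  have hk0 : 0 < ‖k‖ := by
    rw [norm_pos_iff]
    rintro rfl
    have := opSpectralRadius_le_of_growth hA hpos hk (C := 0) le_rfl (fun n => by simp)
    linarith
  by_contra! hcon
  have hcon' : ∀ j : ℕ, ∃ (Δ : ℕ → E) (R : ℝ), Δ 0 = k ∧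
      (∀ n, ‖Δ (n + 1) - A (Δ n)‖ ≤ (1 / ((j : ℝ) + 1)) * ‖Δ n‖) ∧ ∀ n, ‖Δ n‖ ≤ R :=
    fun j => hcon _ (by positivity)
  choose Δ R hΔ0 hΔ hR using hcon'
  have hη : Tendsto (fun j : ℕ => 1 / ((j : ℝ) + 1)) atTop (𝓝 0) :=
    tendsto_one_div_add_atTop_nhds_zero_nat
  have hmax : ∀ j, ∃ n, ∀ m, ‖Δ j m‖ / θ ^ m ≤ ‖Δ j n‖ / θ ^ n := by
    intro j
    refine exists_forall_le_of_tendsto_zero (w := fun m => ‖Δ j m‖ / θ ^ m)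
      (by simpa [hΔ0] using norm_pos_iff.1 hk0) ?_
    have hlim : Tendsto (fun m : ℕ => R j * (θ⁻¹) ^ m) atTop (𝓝 0) := by
      simpa using (tendsto_pow_atTop_nhds_zero_of_lt_one (by positivity)
        (inv_lt_one_of_one_lt₀ hθ1)).const_mul (R j)
    refine squeeze_zero (fun m => by positivity) (fun m => ?_) hlim
    rw [inv_pow, ← div_eq_mul_inv]
    gcongr
    exact hR j m
  choose n hn using hmax
  have hpos' : ∀ j, 0 < ‖Δ j (n j)‖ := by
    intro j
    have h1 := hn j 0
    rw [hΔ0, pow_zero, div_one] at h1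
    by_contra h
    have h' : ‖Δ j (n j)‖ = 0 := le_antisymm (not_lt.1 h) (norm_nonneg _)
    rw [h', zero_div] at h1
    linarith
  let U : Ultrafilter ℕ := hyperfilter ℕ
  have hU : (U : Filter ℕ) ≤ atTop := Nat.hyperfilter_le_atTop
  by_cases hcase : ∀ M, ∀ᶠ j in U, M ≤ n j
  · -- The recentred orbits converge along the ultrafilter to a full orbit of `A`.
    let u : ℕ → ℤ → E := fun j i => ‖Δ j (n j)‖⁻¹ • Δ j (n j + i).toNat
    have hu_norm : ∀ i : ℤ, ∀ᶠ j in U, ‖u j i‖ ≤ θ ^ i := by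
      intro i
      filter_upwards [hcase (-i).toNat] with j hj
      obtain ⟨p, hp⟩ : ∃ p : ℕ, (n j + i : ℤ) = p := ⟨(n j + i).toNat, by omega⟩
      have h1 := hn j p
      have h2 : θ ^ i = θ ^ p / θ ^ n j := by
        rw [← zpow_natCast, ← zpow_natCast, ← zpow_sub₀ hθ0.ne']
        congr 1; omega
      simp only [u]
      rw [norm_smul, norm_inv, norm_norm, inv_mul_le_iff₀ (hpos' j), hp, Int.toNat_natCast, h2]
      rw [div_le_div_iff₀ (by positivity) (by positivity)] at h1
      rw [← mul_div_assoc, le_div_iff₀ (by positivity)]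
      exact h1
    have hu_step : ∀ i : ℤ, Tendsto (fun j => u j (i + 1) - A (u j i)) U (𝓝 0) := by
      intro i
      have hlim : Tendsto (fun j : ℕ => (1 / ((j : ℝ) + 1)) * θ ^ i) U (𝓝 0) := by
        simpa using (hη.mul_const (θ ^ i)).mono_left hU
      refine squeeze_zero_norm' ?_ hlim
      filter_upwards [hcase (-i).toNat, hu_norm i] with j hj hji
      refine le_trans ?_ (mul_le_mul_of_nonneg_left hji (by positivity))
      have e : (n j + (i + 1)).toNat = (n j + i).toNat + 1 := by omega
      simp only [u]
      rw [e, map_smul, ← smul_sub, norm_smul, norm_smul, mul_left_comm]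
      exact mul_le_mul_of_nonneg_left (hΔ j _) (norm_nonneg _)
    have hlim : ∀ i : ℤ, ∃ l, Tendsto (fun j => u j i) U (𝓝 l) := by
      intro i
      obtain ⟨K, hK, hAK⟩ := IsCompactOperator.image_closedBall_subset_compact
        (f := A.toLinearMap) hA (θ ^ (i - 1))
      have hmem : ∀ᶠ j in U, A (u j (i - 1)) ∈ K := by
        filter_upwards [hu_norm (i - 1)] with j hj
        exact hAK (mem_image_of_mem _ (by simpa using hj))
      obtain ⟨l, -, hl⟩ := hK.ultrafilter_le_nhds (U.map fun j => A (u j (i - 1)))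
        (le_principal_iff.2 hmem)
      have hl' : Tendsto (fun j => A (u j (i - 1))) U (𝓝 l) := hl
      refine ⟨l, ?_⟩
      have := (hu_step (i - 1)).add hl'
      simpa using this
    choose l hl using hlim
    have hl_step : ∀ i, l (i + 1) = A (l i) := by
      intro i
      have h1 := (hl (i + 1)).sub ((A.continuous.tendsto (l i)).comp (hl i))
      exact sub_eq_zero.1 (tendsto_nhds_unique h1 (hu_step i))
    have hl0 := hθ l 1 hl_step fun i => by
      rw [one_mul]; exact le_of_tendsto (hl i).norm (hu_norm i)
    have hl1 : ‖l 0‖ = 1 := by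
      refine tendsto_nhds_unique (hl 0).norm ?_
      have : ∀ j, ‖u j 0‖ = 1 := by
        intro j
        simp only [u, add_zero, Int.toNat_natCast]
        rw [norm_smul, norm_inv, norm_norm, inv_mul_cancel₀ (hpos' j).ne']
      simp only [this]
      exact tendsto_const_nhds
    rw [hl0, norm_zero] at hl1
    exact zero_ne_one hl1
  · push Not at hcase
    obtain ⟨M, hM'⟩ := hcase
    have hle : ∀ j m, ‖Δ j m‖ ≤ (‖A‖ + 1) ^ m * ‖k‖ := by
      intro j m
      induction m with
      | zero => simp [hΔ0]
      | succ m ih =>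
        have h1 : 1 / ((j : ℝ) + 1) ≤ 1 := by
          rw [div_le_one (by positivity)]; linarith [(Nat.cast_nonneg j : (0 : ℝ) ≤ j)]
        calc ‖Δ j (m + 1)‖ ≤ ‖Δ j (m + 1) - A (Δ j m)‖ + ‖A (Δ j m)‖ := by
              simpa using norm_add_le (Δ j (m + 1) - A (Δ j m)) (A (Δ j m))
          _ ≤ 1 * ‖Δ j m‖ + ‖A‖ * ‖Δ j m‖ := by
              gcongr
              · exact (hΔ j m).trans (by gcongr)
              · exact A.le_opNorm _
          _ = (‖A‖ + 1) * ‖Δ j m‖ := by ring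
          _ ≤ (‖A‖ + 1) ^ (m + 1) * ‖k‖ := by rw [pow_succ', mul_assoc]; gcongr
    have hconv : ∀ m, Tendsto (fun j => Δ j m) U (𝓝 ((A ^ m) k)) := by
      intro m
      induction m with
      | zero => simp [hΔ0]
      | succ m ih =>
        have h1 : Tendsto (fun j => Δ j (m + 1) - A (Δ j m)) U (𝓝 0) := by
          refine squeeze_zero_norm (hΔ · m) ?_
          simpa using (hη.mono_left hU).mul ih.norm
        have h2 := h1.add ((A.continuous.tendsto _).comp ih)
        rw [pow_succ', mul_apply_eq_comp]
        simpa using h2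
    have hgrowth : ∀ m : ℕ, ‖(A ^ m) k‖ ≤ ((‖A‖ + 1) ^ M * ‖k‖) * θ ^ m := by
      intro m
      refine le_of_tendsto (hconv m).norm ?_
      filter_upwards [hM'] with j hj
      rw [← div_le_iff₀ (by positivity)]
      calc ‖Δ j m‖ / θ ^ m ≤ ‖Δ j (n j)‖ / θ ^ n j := hn j m
        _ ≤ ‖Δ j (n j)‖ := div_le_self (norm_nonneg _) (one_le_pow₀ hθ1.le)
        _ ≤ (‖A‖ + 1) ^ n j * ‖k‖ := hle j _
        _ ≤ (‖A‖ + 1) ^ M * ‖k‖ := by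
          gcongr
          linarith [norm_nonneg A]
    exact absurd (opSpectralRadius_le_of_growth hA hpos hk hθ1.le hgrowth) (not_le.2 hθρ)

end

/-! ### Orbits near an equilibrium -/

section

variable {E : Type*} [NormedAddCommGroup E] {X : Set E} {Φ : ℝ → E → E}

lemma exists_first_hit {f : ℝ → ℝ} {a b R : ℝ} (hab : a ≤ b) (hf : ContinuousOn f (Icc a b))
    (ha : f a < R) (hb : R ≤ f b) : ∃ τ ∈ Icc a b, f τ = R ∧ ∀ t ∈ Icc a τ, f t ≤ R := by
  have hZ : IsCompact (Icc a b ∩ f ⁻¹' Ici R) :=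
    isCompact_Icc.of_isClosed_subset
      (hf.preimage_isClosed_of_isClosed isClosed_Icc isClosed_Ici) inter_subset_left
  obtain ⟨τ, ⟨hτ, hτR⟩, hleast⟩ := hZ.exists_isLeast ⟨b, ⟨hab, le_rfl⟩, hb⟩
  have hlt : ∀ t ∈ Icc a b, t < τ → f t < R := fun t ht htτ => by
    by_contra! h
    exact absurd (hleast ⟨ht, h⟩) (not_le.2 htτ)
  have hτeq : f τ = R := by
    obtain ⟨c, hc, hcR⟩ := intermediate_value_Icc hτ.1 (hf.mono (Icc_subset_Icc_right hτ.2))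
      ⟨ha.le, hτR⟩
    have hcτ : τ ≤ c := hleast ⟨⟨hc.1, hc.2.trans hτ.2⟩, hcR.ge⟩
    rwa [le_antisymm hc.2 hcτ] at hcR
  refine ⟨τ, hτ, hτeq, fun t ht => ?_⟩
  rcases ht.2.eq_or_lt with rfl | h
  · exact hτeq.le
  · exact (hlt t ⟨ht.1, ht.2.trans hτ.2⟩ h).le

namespace IsSemiflowOn

lemma continuousOn_time (hflow : IsSemiflowOn X Φ) {x : E} (hx : x ∈ X) :
    ContinuousOn (fun t => Φ t x) (Ici 0) :=
  hflow.continuousOn.comp (by fun_prop : ContinuousOn (fun t : ℝ => (t, x)) (Ici 0))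
    fun _ ht => ⟨ht, hx⟩

lemma continuousOn_space (hflow : IsSemiflowOn X Φ) {t : ℝ} (ht : 0 ≤ t) :
    ContinuousOn (Φ t) X :=
  hflow.continuousOn.comp (by fun_prop : ContinuousOn (fun x : E => (t, x)) X)
    fun _ hx => ⟨ht, hx⟩

/-- Continuous dependence on the initial point, uniformly on a compact time interval. -/
lemma eventually_forall_dist_lt (hflow : IsSemiflowOn X Φ) {p e : E} (hp : p ∈ X) {T R : ℝ}
    (h : ∀ t ∈ Icc 0 T, dist (Φ t p) e < R) :
    ∀ᶠ y in 𝓝[X] p, ∀ t ∈ Icc 0 T, dist (Φ t y) e < R := by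
  have key : ∀ᶠ y in 𝓝 p, ∀ t ∈ Icc (0 : ℝ) T, 0 ≤ t → y ∈ X → dist (Φ t y) e < R := by
    refine isCompact_Icc.eventually_forall_of_forall_eventually fun t ht => ?_
    have hc := hflow.continuousOn (t, p) ⟨ht.1, hp⟩
    have h1 : ∀ᶠ q in 𝓝[Ici (0 : ℝ) ×ˢ X] (t, p), dist (Φ q.1 q.2) e < R :=
      (hc.dist tendsto_const_nhds).eventually_lt_const (h t ht)
    rw [eventually_nhdsWithin_iff] at h1
    have h2 : Tendsto Prod.swap (𝓝 (p, t)) (𝓝 (t, p)) := continuous_swap.tendsto (p, t)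
    filter_upwards [h2.eventually h1] with q hq h0 hX
    exact hq ⟨h0, hX⟩
  rw [eventually_nhdsWithin_iff]
  filter_upwards [key] with y hy hyX t ht
  exact hy t ht ht.1 hyX

/-- An orbit that is close to `e` during a time interval of length `t₀` and later leaves the ball of
radius `R` meets the sphere of radius `R` at a point of the compact set `L`. -/
lemma exists_exit_point (hflow : IsSemiflowOn X Φ) {t₀ R a b : ℝ} {x e : E} {L : Set E}
    (ht₀ : 0 ≤ t₀) (hL : ∀ y ∈ X, dist y e ≤ R → Φ t₀ y ∈ L) (hx : x ∈ X) (ha : 0 ≤ a)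
    (hnear : ∀ s ∈ Icc a (a + t₀), dist (Φ s x) e < R) (hab : a ≤ b)
    (hb : R ≤ dist (Φ b x) e) :
    ∃ τ, a + t₀ ≤ τ ∧ Φ τ x ∈ L ∧ dist (Φ τ x) e = R := by
  have hcont : ContinuousOn (fun t => dist (Φ t x) e) (Icc a b) :=
    continuous_dist.comp_continuousOn (((hflow.continuousOn_time hx).mono
      fun t (ht : t ∈ Icc a b) => ha.trans ht.1).prodMk continuousOn_const)
  obtain ⟨τ, hτ, hτR, hle⟩ := exists_first_hit hab hcont (hnear a ⟨le_rfl, by linarith⟩) hb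
  have hτ' : a + t₀ ≤ τ := by
    by_contra! h
    exact absurd hτR (hnear τ ⟨hτ.1, h.le⟩).ne
  refine ⟨τ, hτ', ?_, hτR⟩
  have h1 : Φ τ x = Φ t₀ (Φ (τ - t₀) x) := by
    rw [← hflow.map_add _ _ ht₀ (by linarith) x hx, add_sub_cancel]
  rw [h1]
  exact hL _ (hflow.mapsTo _ (by linarith) hx) (hle _ ⟨by linarith, by linarith⟩)

/-- If the omega limit set of `x` is one equilibrium, the orbit of `x` converges to it. The orbit is
not assumed bounded: if it did not converge, it would leave a fixed ball around the equilibrium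
infinitely often, through a compact set, and have another limit point on the sphere. -/
lemma tendsto_of_omegaSet_eq (hflow : IsSemiflowOn X Φ) {t₀ : ℝ} (ht₀ : 0 ≤ t₀)
    (hcompact : IsCompactMapOn X (Φ t₀)) {x e : E} (hx : x ∈ X) (he : e ∈ equilibria X Φ)
    (hω : omegaSet X Φ x = {e}) : Tendsto (fun t => Φ t x) atTop (𝓝 e) := by
  by_contra hnot
  obtain ⟨R, hR, hfar⟩ : ∃ R > 0, ∃ᶠ t in atTop, R ≤ dist (Φ t x) e := by
    rw [Metric.tendsto_nhds] at hnot
    push Not at hnot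
    exact hnot
  obtain ⟨L, hLX, hLc, hL⟩ := hcompact (X ∩ Metric.closedBall e R) inter_subset_left
    (Metric.isBounded_closedBall.subset inter_subset_right)
  have hcl : MapClusterPt e atTop fun t => Φ t x := by
    rw [← mem_omegaLimit_singleton_iff_mapClusterPt]
    have : e ∈ omegaSet X Φ x := by rw [hω]; rfl
    exact this.1
  have hnear := hflow.eventually_forall_dist_lt (T := t₀) (R := R) (e := e) he.1
    fun t ht => by rw [he.2 t ht.1, dist_self]; exact hR
  rw [eventually_nhdsWithin_iff] at hnear
  have hexit : ∀ j : ℕ, ∃ τ : ℝ, (j : ℝ) ≤ τ ∧ Φ τ x ∈ L ∧ dist (Φ τ x) e = R := by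
    intro j
    obtain ⟨a, ha, haj⟩ := ((hcl.frequently hnear).and_eventually
      (eventually_ge_atTop (j : ℝ))).exists
    have ha0 : 0 ≤ a := (Nat.cast_nonneg j).trans haj
    obtain ⟨b, hb, hab⟩ := (hfar.and_eventually (eventually_ge_atTop a)).exists
    obtain ⟨τ, hτ, hτL, hτR⟩ := hflow.exists_exit_point ht₀
      (fun y hy hyR => hL (mem_image_of_mem _ ⟨hy, hyR⟩)) hx ha0 (fun s hs => by
        have := ha (hflow.mapsTo a ha0 hx) (s - a) ⟨by linarith [hs.1], by linarith [hs.2]⟩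
        rwa [← hflow.map_add _ _ (by linarith [hs.1]) ha0 x hx, sub_add_cancel] at this) hab hb
    exact ⟨τ, by linarith, hτL, hτR⟩
  choose τ hτ hτL hτR using hexit
  obtain ⟨y, hyL, φ, hφ, hlim⟩ := hLc.tendsto_subseq hτL
  have hτlim : Tendsto (fun j => τ (φ j)) atTop atTop :=
    tendsto_atTop_mono (fun j => hτ (φ j)) (tendsto_natCast_atTop_atTop.comp hφ.tendsto_atTop)
  have hy : y ∈ omegaSet X Φ x := by
    refine ⟨?_, hLX hyL⟩
    rw [mem_omegaLimit_singleton_iff_mapClusterPt]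
    exact MapClusterPt.of_comp hτlim hlim.mapClusterPt
  rw [hω, mem_singleton_iff] at hy
  have h1 : dist y e = R := tendsto_nhds_unique (hlim.dist tendsto_const_nhds)
    (by simp only [Function.comp_apply, hτR]; exact tendsto_const_nhds)
  rw [hy, dist_self] at h1
  exact hR.ne h1

/-- An orbit that converges to an equilibrium along integer times converges to it. -/
lemma tendsto_of_tendsto_nat (hflow : IsSemiflowOn X Φ) {x e : E} (hx : x ∈ X)
    (he : e ∈ equilibria X Φ) (h : Tendsto (fun n : ℕ => Φ n x) atTop (𝓝 e)) :
    Tendsto (fun t => Φ t x) atTop (𝓝 e) := by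
  rw [Metric.tendsto_atTop]
  intro R hR
  have hnear := hflow.eventually_forall_dist_lt (T := 1) (R := R) (e := e) he.1
    fun t ht => by rw [he.2 t ht.1, dist_self]; exact hR
  rw [eventually_nhdsWithin_iff] at hnear
  obtain ⟨N, hN⟩ := eventually_atTop.1 (h.eventually hnear)
  refine ⟨N, fun t ht => ?_⟩
  have ht0 : 0 ≤ t := (Nat.cast_nonneg N).trans ht
  have h1 := hN ⌊t⌋₊ (Nat.le_floor ht) (hflow.mapsTo _ (Nat.cast_nonneg _) hx)
    (t - ⌊t⌋₊) ⟨sub_nonneg.2 (Nat.floor_le ht0), by linarith [Nat.lt_floor_add_one t]⟩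
  rwa [← hflow.map_add _ _ (sub_nonneg.2 (Nat.floor_le ht0)) (Nat.cast_nonneg _) x hx,
    sub_add_cancel] at h1

lemma tendsto_map_of_tendsto (hflow : IsSemiflowOn X Φ) {x e : E} (hx : x ∈ X) {t : ℝ}
    (ht : 0 ≤ t) (h : Tendsto (fun s => Φ s x) atTop (𝓝 e)) :
    Tendsto (fun s => Φ s (Φ t x)) atTop (𝓝 e) := by
  refine (h.comp (tendsto_atTop_add_const_right atTop t tendsto_id)).congr' ?_
  filter_upwards [eventually_ge_atTop 0] with s hs
  exact hflow.map_add s t hs ht x hx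

/-- An orbit that converges to an equilibrium `e` from another point is, from some time on, close to
`e` but not yet equal to `e`, even if it reaches `e` in finite time. -/
lemma exists_ne_and_forall_dist_lt (hflow : IsSemiflowOn X Φ) {p e : E} (hp : p ∈ X)
    (he : e ∈ equilibria X Φ) (hpe : p ≠ e) (h : Tendsto (fun t => Φ t p) atTop (𝓝 e)) {R : ℝ}
    (hR : 0 < R) : ∃ t, 0 ≤ t ∧ Φ t p ≠ e ∧ ∀ s, t ≤ s → dist (Φ s p) e < R := by
  by_cases hall : ∀ t, 0 ≤ t → Φ t p ≠ e
  · obtain ⟨N, hN⟩ := Metric.tendsto_atTop.1 h R hR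
    exact ⟨max N 0, le_max_right _ _, hall _ (le_max_right _ _),
      fun s hs => hN s ((le_max_left _ _).trans hs)⟩
  push Not at hall
  -- `τ` is the arrival time at `e`; a slightly smaller time has the required property.
  let Z := Ici (0 : ℝ) ∩ (fun t => Φ t p) ⁻¹' {e}
  have hZc : IsClosed Z :=
    (hflow.continuousOn_time hp).preimage_isClosed_of_isClosed isClosed_Ici isClosed_singleton
  have hZne : Z.Nonempty := let ⟨t, ht, hte⟩ := hall; ⟨t, ht, hte⟩
  have hZbd : BddBelow Z := ⟨0, fun t ht => ht.1⟩
  obtain ⟨hτ0, hτe⟩ : sInf Z ∈ Z := hZc.csInf_mem hZne hZbd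
  set τ := sInf Z with hτ
  have hτpos : 0 < τ := by
    refine lt_of_le_of_ne hτ0 fun h0 => hpe ?_
    rw [← hflow.map_zero p hp, h0]; exact hτe
  have hlate : ∀ s, τ ≤ s → Φ s p = e := by
    intro s hs
    have h1 := hflow.map_add (s - τ) τ (sub_nonneg.2 hs) hτ0 p hp
    rw [sub_add_cancel] at h1
    rw [h1, show Φ τ p = e from hτe, he.2 _ (sub_nonneg.2 hs)]
  have hev : ∀ᶠ s in 𝓝 τ, dist (Φ s p) e < R := by
    have hc : ContinuousAt (fun t => Φ t p) τ :=
      (hflow.continuousOn_time hp).continuousAt (Ici_mem_nhds hτpos)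
    have h1 : Tendsto (fun t => dist (Φ t p) e) (𝓝 τ) (𝓝 (dist (Φ τ p) e)) :=
      Tendsto.dist hc tendsto_const_nhds
    refine h1.eventually_lt_const ?_
    rw [show Φ τ p = e from hτe, dist_self]; exact hR
  obtain ⟨δ, hδ, hball⟩ := Metric.eventually_nhds_iff.1 hev
  refine ⟨max 0 (τ - δ / 2), le_max_left _ _, fun hcon => ?_, fun s hs => ?_⟩
  · have h1 : max 0 (τ - δ / 2) ∈ Z := ⟨mem_Ici.2 (le_max_left _ _), hcon⟩
    have h2 : max 0 (τ - δ / 2) < τ := max_lt hτpos (by linarith)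
    exact absurd (csInf_le hZbd h1) (not_le.2 h2)
  · rcases le_or_gt τ s with h1 | h1
    · rw [hlate s h1, dist_self]; exact hR
    · refine hball ?_
      rw [Real.dist_eq, abs_lt]
      have := (le_max_right _ _).trans hs
      constructor <;> linarith

end IsSemiflowOn

end

/-! ### Linearly unstable equilibria do not attract ordered triples -/

lemma IsPConvex.segment_subset {E : Type*} [NormedAddCommGroup E] [NormedSpace ℝ E]
    [PartialOrder E] {X : Set E} (hX : IsPConvex X) {a b : E} (ha : a ∈ X) (hb : b ∈ X)
    (hab : a ≤ b) : segment ℝ a b ⊆ X := by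
  rintro _ ⟨s, t, hs, ht, hst, rfl⟩
  rcases hab.eq_or_lt with rfl | hlt
  · rwa [← add_smul, hst, one_smul]
  rcases hs.eq_or_lt with rfl | hs
  · rw [zero_add] at hst; simpa [hst] using hb
  rcases ht.eq_or_lt with rfl | ht
  · rw [add_zero] at hst; simpa [hst] using ha
  have := hX a ha b hb hlt s hs (by linarith)
  rwa [← hst, add_sub_cancel_left] at this

section

variable {E : Type*} [NormedAddCommGroup E] [PartialOrder E] {X : Set E} {Φ : ℝ → E → E} {t₀ : ℝ}

/-- A point lying strictly between `r` and `q` has a neighbourhood whose orbits are sandwiched, from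
some time on, between those of `r` and `q`. -/
lemma IsSOP.eventually_between (hflow : IsSemiflowOn X Φ) (hsop : IsSOP X Φ) {r p q : E}
    (hr : r ∈ X) (hp : p ∈ X) (hq : q ∈ X) (hrp : r < p) (hpq : p < q) :
    ∃ T, 0 ≤ T ∧ ∀ᶠ u in 𝓝[X] p, ∀ t, T ≤ t → Φ t r ≤ Φ t u ∧ Φ t u ≤ Φ t q := by
  obtain ⟨U₁, V₁, -, hV₁, hrU, hpV, s₁, hs₁, h₁⟩ := hsop.strong r hr p hp hrp
  obtain ⟨U₂, V₂, hU₂, -, hpU, hqV, s₂, hs₂, h₂⟩ := hsop.strong p hp q hq hpq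
  have later : ∀ x ∈ X, ∀ y ∈ X, ∀ s, 0 ≤ s → Φ s x ≤ Φ s y → ∀ t, s ≤ t → Φ t x ≤ Φ t y := by
    intro x hx y hy s hs hxy t hst
    have := hsop.monotone _ (hflow.mapsTo s hs hx) _ (hflow.mapsTo s hs hy) hxy (t - s)
      (sub_nonneg.2 hst)
    rwa [← hflow.map_add _ _ (sub_nonneg.2 hst) hs x hx,
      ← hflow.map_add _ _ (sub_nonneg.2 hst) hs y hy, sub_add_cancel] at this
  refine ⟨max s₁ s₂, hs₁.trans (le_max_left _ _), ?_⟩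
  filter_upwards [mem_nhdsWithin_of_mem_nhds (hV₁.mem_nhds hpV),
    mem_nhdsWithin_of_mem_nhds (hU₂.mem_nhds hpU), self_mem_nhdsWithin] with u hu1 hu2 huX t ht
  exact ⟨later r hr u huX s₁ hs₁ (h₁ r ⟨hrU, hr⟩ u ⟨hu1, huX⟩) t ((le_max_left _ _).trans ht),
    later u huX q hq s₂ hs₂ (h₂ u ⟨hu2, huX⟩ q ⟨hqV, hq⟩) t ((le_max_right _ _).trans ht)⟩

/-- If `r < p < q`, the orbits of `r` and `q` converge to `e` and that of `p` stays near `e`, then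
all orbits issuing near `p` stay near `e`. The order intervals need not be bounded, but an orbit can
leave a ball only through a compact set, where the sandwich forces it to be near `e`. -/
lemma IsSOP.eventually_forall_dist_le [OrderClosedTopology E] (hflow : IsSemiflowOn X Φ)
    (hsop : IsSOP X Φ) (ht₀ : 0 ≤ t₀) (hcompact : IsCompactMapOn X (Φ t₀)) {r p q e : E} (hr : r ∈ X) (hp : p ∈ X) (hq : q ∈ X)
    (hrp : r < p) (hpq : p < q) (hre : Tendsto (fun t => Φ t r) atTop (𝓝 e))
    (hqe : Tendsto (fun t => Φ t q) atTop (𝓝 e)) {R : ℝ} (hR : 0 < R)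
    (hpR : ∀ t, 0 ≤ t → dist (Φ t p) e < R) :
    ∀ᶠ u in 𝓝[X] p, ∀ t, 0 ≤ t → dist (Φ t u) e ≤ R := by
  obtain ⟨T, -, hT⟩ := hsop.eventually_between hflow hr hp hq hrp hpq
  obtain ⟨L, hLX, hLc, hL⟩ := hcompact (X ∩ Metric.closedBall e R) inter_subset_left
    (Metric.isBounded_closedBall.subset inter_subset_right)
  by_contra hcon
  rw [not_eventually] at hcon
  have hexit : ∀ j : ℕ, ∃ τ y, (j : ℝ) ≤ τ ∧ T ≤ τ ∧ y ∈ L ∧ dist y e = R ∧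
      Φ τ r ≤ y ∧ y ≤ Φ τ q := by
    intro j
    have hnear := hflow.eventually_forall_dist_lt hp (T := max (j : ℝ) T + t₀) (R := R) (e := e)
      fun t ht => hpR t ht.1
    obtain ⟨u, hu, huT, hun, huX⟩ := (hcon.and_eventually
      (hT.and (hnear.and self_mem_nhdsWithin))).exists
    push Not at hu
    obtain ⟨b, hb0, hb⟩ := hu
    have hj0 : (0 : ℝ) ≤ max (j : ℝ) T := (Nat.cast_nonneg j).trans (le_max_left _ _)
    have hbj : max (j : ℝ) T ≤ b := by
      by_contra! h
      exact absurd hb (not_lt.2 (hun b ⟨hb0, by linarith⟩).le)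
    obtain ⟨τ, hτ, hτL, hτR⟩ := hflow.exists_exit_point ht₀
      (fun y hy hyR => hL (mem_image_of_mem _ ⟨hy, hyR⟩)) huX hj0
      (fun s hs => hun s ⟨hj0.trans hs.1, hs.2⟩) hbj hb.le
    have hτj : max (j : ℝ) T ≤ τ := by linarith
    have hτT := (le_max_right _ _).trans hτj
    exact ⟨τ, Φ τ u, (le_max_left _ _).trans hτj, hτT, hτL, hτR, huT τ hτT⟩
  choose τ y hτj hτT hyL hyR hry hyq using hexit
  obtain ⟨z, -, φ, hφ, hlim⟩ := hLc.tendsto_subseq hyL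
  have hτlim : Tendsto (fun j => τ (φ j)) atTop atTop :=
    tendsto_atTop_mono (fun j => hτj (φ j)) (tendsto_natCast_atTop_atTop.comp hφ.tendsto_atTop)
  have h1 : e ≤ z := le_of_tendsto_of_tendsto' (hre.comp hτlim) hlim fun j => hry _
  have h2 : z ≤ e := le_of_tendsto_of_tendsto' hlim (hqe.comp hτlim) fun j => hyq _
  have h3 : dist z e = R := tendsto_nhds_unique (hlim.dist tendsto_const_nhds)
    (by simp only [Function.comp_apply, hyR]; exact tendsto_const_nhds)
  rw [le_antisymm h2 h1, dist_self] at h3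
  exact hR.ne h3

end

section

variable {E : Type*} [NormedAddCommGroup E] [NormedSpace ℝ E] [PartialOrder E]
  [IsOrderedAddMonoid E] [PosSMulMono ℝ E]
  {X : Set E} {Φ : ℝ → E → E} {t₀ : ℝ}

/-- The derivative of an order preserving map is positive, also at boundary points of `X`. -/
lemma HasC1DerivOn.apply_nonneg [OrderClosedTopology E] {f : E → E} {D : E → E →L[ℝ] E}
    (hf : HasC1DerivOn X f D)
    (hXint : X ⊆ closure (interior X)) (hmono : ∀ x ∈ X, ∀ y ∈ X, x ≤ y → f x ≤ f y)
    {x : E} (hx : x ∈ X) {k : E} (hk : 0 ≤ k) : 0 ≤ D x k := by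
  have hint : ∀ y ∈ interior X, 0 ≤ D y k := by
    intro y hy
    have hX : X ∈ 𝓝 y := mem_interior_iff_mem_nhds.1 hy
    have hd : HasFDerivAt f (D y) y :=
      (hf.hasFDerivWithinAt y (interior_subset hy)).hasFDerivAt hX
    have hlim := (hd.hasLineDerivAt k).tendsto_slope_zero_right
    have hmem : ∀ᶠ t : ℝ in 𝓝[>] 0, y + t • k ∈ X := by
      have hc : Tendsto (fun t : ℝ => y + t • k) (𝓝 0) (𝓝 y) := by
        have : Continuous fun t : ℝ => y + t • k := by fun_prop
        simpa using this.tendsto 0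
      exact (hc.mono_left nhdsWithin_le_nhds).eventually hX
    refine ge_of_tendsto hlim ?_
    filter_upwards [hmem, self_mem_nhdsWithin] with t ht ht0
    have ht0' : (0 : ℝ) < t := ht0
    refine smul_nonneg (inv_nonneg.2 ht0'.le) (sub_nonneg.2 ?_)
    exact hmono y (interior_subset hy) _ ht (le_add_of_nonneg_right (smul_nonneg ht0'.le hk))
  have : (𝓝[interior X] x).NeBot := mem_closure_iff_nhdsWithin_neBot.1 (hXint hx)
  have hc : Tendsto (fun y => D y k) (𝓝[interior X] x) (𝓝 (D x k)) :=
    (((hf.continuousOn x hx).mono interior_subset).clm_apply continuousWithinAt_const)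
  exact ge_of_tendsto hc (eventually_nhdsWithin_of_forall hint)

/-- A linearly unstable equilibrium `e` has a ball such that no ordered triple `r < p < q` converges
to `e` with the orbit of `p` staying in the ball. Indeed orbits issuing near `p` would stay in the
ball, in particular those of two interior points `a` and `a + ε k` of `X`, and their difference would
be a bounded perturbed orbit of the derivative at `e`. -/
lemma exists_radius_no_trapped_triple [OrderClosedTopology E]
    (hcone : (interior (Ici (0 : E))).Nonempty) (hXpc : IsPConvex X)
    (hXint : X ⊆ closure (interior X)) (hflow : IsSemiflowOn X Φ) (hsop : IsSOP X Φ)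
    (ht₀ : 0 ≤ t₀) (hcompact : IsCompactMapOn X (Φ t₀)) {D : E → E →L[ℝ] E}
    (hderiv : HasC1DerivOn X (Φ t₀) D) {e : E} (he : e ∈ equilibria X Φ)
    (hDcompact : IsCompactOperator (D e)) (hρ : 1 < opSpectralRadius (D e)) :
    ∃ R > 0, ∀ r ∈ X, ∀ p ∈ X, ∀ q ∈ X, r < p → p < q →
      Tendsto (fun t => Φ t r) atTop (𝓝 e) → Tendsto (fun t => Φ t q) atTop (𝓝 e) →
      ∃ t, 0 ≤ t ∧ R ≤ dist (Φ t p) e := by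
  obtain ⟨k, hk⟩ := hcone
  have hk0 : 0 ≤ k := interior_subset hk
  have hpos : ∀ x, 0 ≤ x → 0 ≤ D e x := fun x hx =>
    hderiv.apply_nonneg hXint (fun x hx y hy hxy => hsop.monotone x hx y hy hxy t₀ ht₀) he.1 hx
  obtain ⟨η, hη, hunb⟩ := exists_forall_perturbed_orbit_unbounded hDcompact hpos hk hρ
  obtain ⟨R₀, hR₀, hDR⟩ := Metric.continuousWithinAt_iff.1 (hderiv.continuousOn e he.1) η hη
  refine ⟨R₀ / 2, by positivity, fun r hr p hp q hq hrp hpq hre hqe => ?_⟩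
  by_contra! hpR
  set R := R₀ / 2 with hR
  have hev := hsop.eventually_forall_dist_le hflow ht₀ hcompact hr hp hq hrp hpq hre hqe
    (by positivity) hpR
  rw [eventually_nhdsWithin_iff] at hev
  obtain ⟨W, hW, hWo, hpW⟩ := mem_nhds_iff.1 hev
  obtain ⟨a, haW, haX⟩ := mem_closure_iff.1 (hXint hp) W hWo hpW
  obtain ⟨ε, hε, haε⟩ : ∃ ε : ℝ, 0 < ε ∧ a + ε • k ∈ W ∩ interior X := by
    have hc : Tendsto (fun t : ℝ => a + t • k) (𝓝[>] 0) (𝓝 a) := by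
      have : Continuous fun t : ℝ => a + t • k := by fun_prop
      simpa using (this.tendsto 0).mono_left (nhdsWithin_le_nhds (s := Ioi 0))
    obtain ⟨ε, h1, h2⟩ := ((hc.eventually ((hWo.inter isOpen_interior).mem_nhds ⟨haW, haX⟩)).and
      self_mem_nhdsWithin).exists
    exact ⟨ε, h2, h1⟩
  set b := a + ε • k with hb
  have haX' : a ∈ X := interior_subset haX
  have hbX' : b ∈ X := interior_subset haε.2
  have hab : a ≤ b := le_add_of_nonneg_right (smul_nonneg hε.le hk0)
  have htime : ∀ n : ℕ, 0 ≤ n * t₀ := fun n => by positivity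
  let f : ℕ → E := fun n => Φ (n * t₀) a
  let g : ℕ → E := fun n => Φ (n * t₀) b
  have hfX : ∀ n, f n ∈ X := fun n => hflow.mapsTo _ (htime n) haX'
  have hgX : ∀ n, g n ∈ X := fun n => hflow.mapsTo _ (htime n) hbX'
  have hfR : ∀ n, dist (f n) e ≤ R := fun n => hW haW haX' _ (htime n)
  have hgR : ∀ n, dist (g n) e ≤ R := fun n => hW haε.1 hbX' _ (htime n)
  have hfg : ∀ n, f n ≤ g n := fun n => hsop.monotone a haX' b hbX' hab _ (htime n)
  have hstep : ∀ x ∈ X, ∀ n : ℕ, Φ ((n + 1 : ℕ) * t₀) x = Φ t₀ (Φ (n * t₀) x) := by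
    intro x hx n
    rw [← hflow.map_add _ _ ht₀ (htime n) x hx]
    congr 1; push_cast; ring
  let Δ : ℕ → E := fun n => ε⁻¹ • (g n - f n)
  obtain ⟨n, hn⟩ := hunb Δ (ε⁻¹ * (R + R)) (by
    simp only [Δ, f, g, Nat.cast_zero, zero_mul, hflow.map_zero a haX', hflow.map_zero b hbX']
    rw [hb, add_sub_cancel_left, smul_smul, inv_mul_cancel₀ hε.ne', one_smul]) (by
    intro n
    have hseg : segment ℝ (f n) (g n) ⊆ X := hXpc.segment_subset (hfX n) (hgX n) (hfg n)
    have hball : segment ℝ (f n) (g n) ⊆ Metric.closedBall e R :=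
      (convex_closedBall e R).segment_subset (hfR n) (hgR n)
    have hmv := Convex.norm_image_sub_le_of_norm_hasFDerivWithin_le' (φ := D e) (C := η)
      (fun x hx => (hderiv.hasFDerivWithinAt x (hseg hx)).mono hseg)
      (fun x hx => by
        rw [← dist_eq_norm]
        refine (hDR (hseg hx) ((hball hx).trans_lt ?_)).le
        rw [hR]; linarith)
      (convex_segment (f n) (g n)) (left_mem_segment ℝ _ _) (right_mem_segment ℝ _ _)
    have e1 : Δ (n + 1) - D e (Δ n) = ε⁻¹ • (Φ t₀ (g n) - Φ t₀ (f n) - D e (g n - f n)) := by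
      simp only [Δ, map_smul, ← smul_sub]
      simp only [f, g, hstep a haX', hstep b hbX']
    rw [e1]
    simp only [Δ]
    rw [norm_smul, norm_smul, mul_left_comm]
    exact mul_le_mul_of_nonneg_left hmv (norm_nonneg _))
  refine absurd hn (not_lt.2 ?_)
  simp only [Δ]
  rw [norm_smul, norm_inv, Real.norm_of_nonneg hε.le, ← dist_eq_norm]
  gcongr
  exact (dist_triangle_right _ _ e).trans (add_le_add (hgR n) (hfR n))

/-- If two points with `a ≪ b` are mapped to the same point at time `t`, this point is the limit of
their orbits: the whole order interval between them is collapsed, so a short piece of the orbit of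
its midpoint is, and the image is an equilibrium. -/
lemma IsSOP.eq_limit_of_map_eq (hflow : IsSemiflowOn X Φ) (hsop : IsSOP X Φ) (hXpc : IsPConvex X)
    {a b e : E} (ha : a ∈ X) (hb : b ∈ X) (hab : ConeLT a b)
    (hlim : Tendsto (fun t => Φ t a) atTop (𝓝 e)) {t : ℝ} (ht : 0 ≤ t) (heq : Φ t a = Φ t b) :
    Φ t a = e := by
  have hab' : a ≤ b := sub_nonneg.1 (interior_subset hab)
  set z : E := (1 / 2 : ℝ) • a + (1 / 2 : ℝ) • b with hz
  have hzX : z ∈ X := hXpc.segment_subset ha hb hab'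
    ⟨1 / 2, 1 / 2, by norm_num, by norm_num, by norm_num, rfl⟩
  obtain ⟨c, hc0, hc⟩ := exists_order_unit_bound hab
  have hza : z - (1 / 2 : ℝ) • (b - a) = a := by rw [hz]; module
  have hzb : z + (1 / 2 : ℝ) • (b - a) = b := by rw [hz]; module
  have hcollapse : ∀ y ∈ X, c * ‖y - z‖ ≤ 1 / 2 → Φ t y = Φ t a := by
    intro y hy hyz
    have h0 : 0 ≤ b - a := sub_nonneg.2 hab'
    have h1 : (c * ‖y - z‖) • (b - a) ≤ (1 / 2 : ℝ) • (b - a) := by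
      rw [← sub_nonneg, ← sub_smul]
      exact smul_nonneg (by linarith) h0
    have h2 : a ≤ y := by
      rw [← hza, sub_le_iff_le_add', ← sub_le_iff_le_add]
      have := (neg_le_neg h1).trans (hc (y - z)).1
      have h3 := neg_le.1 this
      rwa [neg_sub] at h3
    have h3 : y ≤ b := by
      rw [← hzb, ← sub_le_iff_le_add']
      exact (hc (y - z)).2.trans h1
    refine le_antisymm ?_ (hsop.monotone a ha y hy h2 t ht)
    rw [heq]
    exact hsop.monotone y hy b hb h3 t ht
  have hev : ∀ᶠ s in 𝓝[≥] (0 : ℝ), c * ‖Φ s z - z‖ < 1 / 2 := by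
    have h1 := hflow.continuousOn_time hzX 0 self_mem_Ici
    have h2 : Tendsto (fun s => c * ‖Φ s z - z‖) (𝓝[≥] 0) (𝓝 (c * ‖Φ 0 z - z‖)) :=
      ((h1.sub continuousWithinAt_const).norm.const_mul c)
    refine h2.eventually_lt_const ?_
    rw [hflow.map_zero z hzX, sub_self, norm_zero, mul_zero]; norm_num
  obtain ⟨h, hh0, hh⟩ : ∃ h : ℝ, 0 < h ∧ c * ‖Φ h z - z‖ < 1 / 2 := by
    obtain ⟨h, h1, h2⟩ := ((hev.filter_mono (nhdsWithin_mono _ Ioi_subset_Ici_self)).and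
      self_mem_nhdsWithin).exists
    exact ⟨h, h2, h1⟩
  set P := Φ t a with hP
  have hPX : P ∈ X := hflow.mapsTo t ht ha
  have hPz : Φ t z = P := hcollapse z hzX (by simp)
  have hPh : Φ h P = P := by
    rw [← hPz, ← hflow.map_add h t hh0.le ht z hzX, add_comm, hflow.map_add t h ht hh0.le z hzX,
      hcollapse _ (hflow.mapsTo h hh0.le hzX) hh.le, hPz]
  have hPn : ∀ n : ℕ, Φ (n * h) P = P := by
    intro n
    induction n with
    | zero => simpa using hflow.map_zero P hPX
    | succ n ih =>
      have : ((n + 1 : ℕ) : ℝ) * h = n * h + h := by push_cast; ring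
      rw [this, hflow.map_add _ _ (by positivity) hh0.le P hPX, hPh, ih]
  have h1 : Tendsto (fun n : ℕ => Φ (n * h) P) atTop (𝓝 e) :=
    (hflow.tendsto_map_of_tendsto ha ht hlim).comp
      (tendsto_natCast_atTop_atTop.atTop_mul_const hh0)
  simp only [hPn] at h1
  exact tendsto_nhds_unique tendsto_const_nhds h1

/-- Of three points `a ≪ p ≪ b` whose orbits converge to a linearly unstable equilibrium, the middle
one is the equilibrium. -/
lemma eq_of_coneLT_of_coneLT_of_tendsto [OrderClosedTopology E]
    (hcone : (interior (Ici (0 : E))).Nonempty) (hXpc : IsPConvex X)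
    (hXint : X ⊆ closure (interior X)) (hflow : IsSemiflowOn X Φ) (hsop : IsSOP X Φ)
    (ht₀ : 0 ≤ t₀) (hcompact : IsCompactMapOn X (Φ t₀)) {D : E → E →L[ℝ] E}
    (hderiv : HasC1DerivOn X (Φ t₀) D) {e : E} (he : e ∈ equilibria X Φ)
    (hDcompact : IsCompactOperator (D e)) (hρ : 1 < opSpectralRadius (D e))
    {a p b : E} (ha : a ∈ X) (hp : p ∈ X) (hb : b ∈ X) (hap : ConeLT a p) (hpb : ConeLT p b)
    (hae : Tendsto (fun t => Φ t a) atTop (𝓝 e)) (hpe : Tendsto (fun t => Φ t p) atTop (𝓝 e))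
    (hbe : Tendsto (fun t => Φ t b) atTop (𝓝 e)) : p = e := by
  by_contra hne
  obtain ⟨R, hR, htriple⟩ := exists_radius_no_trapped_triple hcone hXpc hXint hflow hsop ht₀
    hcompact hderiv he hDcompact hρ
  obtain ⟨t, ht, hte, htR⟩ := hflow.exists_ne_and_forall_dist_lt hp he hne hpe hR
  have h1 : Φ t a < Φ t p := by
    refine lt_of_le_of_ne (hsop.monotone a ha p hp (sub_nonneg.1 (interior_subset hap)) t ht)
      fun h => hte ?_
    rw [← h]; exact hsop.eq_limit_of_map_eq hflow hXpc ha hp hap hae ht h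
  have h2 : Φ t p < Φ t b :=
    lt_of_le_of_ne (hsop.monotone p hp b hb (sub_nonneg.1 (interior_subset hpb)) t ht)
      fun h => hte (hsop.eq_limit_of_map_eq hflow hXpc hp hb hpb hpe ht h)
  obtain ⟨s, hs, hsR⟩ := htriple _ (hflow.mapsTo t ht ha) _ (hflow.mapsTo t ht hp) _
    (hflow.mapsTo t ht hb) h1 h2 (hflow.tendsto_map_of_tendsto ha ht hae)
    (hflow.tendsto_map_of_tendsto hb ht hbe)
  rw [← hflow.map_add s t hs ht p hp] at hsR
  exact absurd hsR (not_le.2 (htR _ (by linarith)))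

/-- A linearly unstable irreducible equilibrium is isolated among the equilibria comparable to it:
the normalized differences from equilibria converging to it would accumulate at a positive fixed
vector of the derivatives, which is an interior point of the cone by irreducibility. -/
lemma eventually_not_comparable [OrderClosedTopology E]
    (hXint : X ⊆ closure (interior X)) (hsop : IsSOP X Φ) (ht₀ : 0 ≤ t₀)
    {D : ℝ → E → E →L[ℝ] E} (hderiv : ∀ t : ℝ, t₀ ≤ t → HasC1DerivOn X (Φ t) (D t))
    {e : E} (he : e ∈ equilibria X Φ) (hDcompact : IsCompactOperator (D t₀ e))
    (hirr : IsIrreducibleAt t₀ D e) (hρ : 1 < opSpectralRadius (D t₀ e)) :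
    ∀ᶠ x in 𝓝[≠] e, x ∈ equilibria X Φ → ¬ (e ≤ x ∨ x ≤ e) := by
  by_contra hcon
  rw [not_eventually] at hcon
  obtain ⟨x, hx, hxe⟩ := exists_seq_forall_of_frequently (hcon.and_eventually self_mem_nhdsWithin)
  have hxE : ∀ n, x n ∈ equilibria X Φ := fun n => (Classical.not_imp.1 (hxe n).1).1
  have hxc : ∀ n, e ≤ x n ∨ x n ≤ e := fun n => not_not.1 (Classical.not_imp.1 (hxe n).1).2
  have hx0 : ∀ n, 0 < ‖x n - e‖ := fun n => norm_pos_iff.2 (sub_ne_zero.2 (hxe n).2)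
  have hsign : ∀ n, ∃ σ : ℝ, |σ| = 1 ∧ 0 ≤ σ • (x n - e) := by
    intro n
    rcases hxc n with h | h
    · exact ⟨1, abs_one, by simpa using h⟩
    · exact ⟨-1, by simp, by simpa using h⟩
  choose σ hσ hσx using hsign
  let u : ℕ → E := fun n => ‖x n - e‖⁻¹ • σ n • (x n - e)
  have hu0 : ∀ n, 0 ≤ u n := fun n => smul_nonneg (inv_nonneg.2 (norm_nonneg _)) (hσx n)
  have hu1 : ∀ n, ‖u n‖ = 1 := by
    intro n
    simp only [u]
    rw [norm_smul, norm_smul, Real.norm_eq_abs (σ n), hσ, one_mul, norm_inv, norm_norm,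
      inv_mul_cancel₀ (hx0 n).ne']
  have hxX : Tendsto x atTop (𝓝[X] e) := by
    rw [tendsto_nhdsWithin_iff]
    exact ⟨hx.mono_right nhdsWithin_le_nhds, Eventually.of_forall fun n => (hxE n).1⟩
  have hfix : ∀ t, t₀ ≤ t → Tendsto (fun n => u n - D t e (u n)) atTop (𝓝 0) := by
    intro t ht
    have h1 := (((hderiv t ht).hasFDerivWithinAt e he.1).isLittleO.comp_tendsto
      hxX).norm_norm.tendsto_div_nhds_zero
    refine squeeze_zero_norm (fun n => le_of_eq ?_) h1
    have ht' : 0 ≤ t := ht₀.trans ht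
    simp only [u, Function.comp_apply]
    rw [(hxE n).2 t ht', he.2 t ht', map_smul, map_smul, ← smul_sub, ← smul_sub, norm_smul,
      norm_smul, Real.norm_eq_abs (σ n), hσ, one_mul, norm_inv, norm_norm, inv_mul_eq_div]
  obtain ⟨K, hK, hDK⟩ :=
    IsCompactOperator.image_closedBall_subset_compact (f := (D t₀ e).toLinearMap) hDcompact 1
  obtain ⟨y, -, φ, hφ, hlim⟩ := hK.tendsto_subseq fun n =>
    hDK (mem_image_of_mem _ (by simp [hu1] : u n ∈ Metric.closedBall 0 1))
  have huy : Tendsto (fun n => u (φ n)) atTop (𝓝 y) := by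
    have := ((hfix t₀ le_rfl).comp hφ.tendsto_atTop).add hlim
    simpa [Function.comp_def] using this
  have hDy : ∀ t, t₀ ≤ t → D t e y = y := by
    intro t ht
    have h1 := huy.sub (((D t e).continuous.tendsto y).comp huy)
    exact (sub_eq_zero.1 (tendsto_nhds_unique h1 ((hfix t ht).comp hφ.tendsto_atTop))).symm
  have hy0 : 0 ≤ y := ge_of_tendsto' huy fun n => hu0 _
  have hy1 : ‖y‖ = 1 := tendsto_nhds_unique huy.norm (by simp only [hu1]; exact tendsto_const_nhds)
  have hypos : 0 < y := lt_of_le_of_ne hy0 fun h => by simp [← h] at hy1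
  obtain ⟨t, -, ht, hstrong⟩ := hirr
  have hyint : y ∈ interior (Ici (0 : E)) := by
    have := hstrong y hypos
    rwa [ConeLT, sub_zero, hDy t ht] at this
  have hpow : ∀ n : ℕ, (D t₀ e ^ n) y = y := by
    intro n
    induction n with
    | zero => simp
    | succ n ih => rw [pow_succ, mul_apply_eq_comp, hDy t₀ le_rfl, ih]
  have hle := opSpectralRadius_le_of_growth hDcompact
    (fun z hz => (hderiv t₀ le_rfl).apply_nonneg hXint
      (fun a ha b hb hab => hsop.monotone a ha b hb hab t₀ ht₀) he.1 hz) hyint le_rfl (C := 1)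
    (fun n => by rw [hpow, hy1]; simp)
  exact absurd hle (not_le.2 hρ)

end

/-! ### Measurability, and lines in the direction of the cone -/

/-- The linearly unstable equilibria. -/
def unstableEquilibria {E : Type*} [NormedAddCommGroup E] [NormedSpace ℝ E]
    (X : Set E) (Φ : ℝ → E → E) (D : E → E →L[ℝ] E) : Set E :=
  {e | e ∈ equilibria X Φ ∧ 1 < opSpectralRadius (D e)}

/-- The points of `X` whose orbit converges to a linearly unstable equilibrium. Integer times suffice
and make the set visibly Borel. -/
def unstableBasin {E : Type*} [NormedAddCommGroup E] [NormedSpace ℝ E]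
    (X : Set E) (Φ : ℝ → E → E) (D : E → E →L[ℝ] E) : Set E :=
  {x | x ∈ X ∧ ∃ e ∈ unstableEquilibria X Φ D, Tendsto (fun n : ℕ => Φ n x) atTop (𝓝 e)}

section

variable {E : Type*} [NormedAddCommGroup E] [NormedSpace ℝ E] {X : Set E} {Φ : ℝ → E → E}

lemma measurableSet_unstableEquilibria [MeasurableSpace E] [BorelSpace E]
    (hX : MeasurableSet X) (hflow : IsSemiflowOn X Φ) {D : E → E →L[ℝ] E}
    (hD : ContinuousOn D X) : MeasurableSet (unstableEquilibria X Φ D) := by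
  have hD' : Continuous fun x : X => D x := continuousOn_iff_continuous_domRestrict.1 hD
  have h1 : IsClosed {x : X | ∀ t : ℝ, 0 ≤ t → Φ t x = x} := by
    simp only [ofPred_forall]
    exact isClosed_iInter fun t => isClosed_iInter fun ht => isClosed_eq
      (continuousOn_iff_continuous_domRestrict.1 (hflow.continuousOn_space ht)) continuous_subtype_val
  have h2 : Measurable fun x : X => opSpectralRadius (D x) := by
    refine Measurable.limsup fun n => ?_
    exact ((hD'.pow n).norm.rpow_const fun _ => Or.inr (by positivity)).measurable
  have h3 : unstableEquilibria X Φ D = Subtype.val ''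
      ({x : X | ∀ t : ℝ, 0 ≤ t → Φ t x = x} ∩ {x : X | 1 < opSpectralRadius (D x)}) := by
    ext e
    constructor
    · rintro ⟨⟨heX, he⟩, hρ⟩
      exact ⟨⟨e, heX⟩, ⟨he, hρ⟩, rfl⟩
    · rintro ⟨⟨e, heX⟩, ⟨he, hρ⟩, rfl⟩
      exact ⟨⟨heX, he⟩, hρ⟩
  rw [h3]
  exact hX.subtype_image (h1.measurableSet.inter (measurableSet_lt measurable_const h2))

lemma measurableSet_unstableBasin [CompleteSpace E] [TopologicalSpace.SeparableSpace E]
    [MeasurableSpace E] [BorelSpace E] (hX : MeasurableSet X) (hflow : IsSemiflowOn X Φ)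
    {D : E → E →L[ℝ] E} (hD : ContinuousOn D X) : MeasurableSet (unstableBasin X Φ D) := by
  have : SecondCountableTopology E := UniformSpace.secondCountable_of_separable E
  have hf : ∀ n : ℕ, StronglyMeasurable fun x : X => Φ n x := fun n =>
    (continuousOn_iff_continuous_domRestrict.1
      (hflow.continuousOn_space (Nat.cast_nonneg n))).measurable.stronglyMeasurable
  have h1 : MeasurableSet {x : X | ∃ c, Tendsto (fun n : ℕ => Φ n x) atTop (𝓝 c)} :=
    StronglyMeasurable.measurableSet_exists_tendsto hf
  have h2 : Measurable fun x : X => limUnder atTop fun n : ℕ => Φ n x :=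
    (StronglyMeasurable.limUnder hf).measurable
  have h3 : unstableBasin X Φ D = Subtype.val ''
      ({x : X | ∃ c, Tendsto (fun n : ℕ => Φ n x) atTop (𝓝 c)} ∩
        (fun x : X => limUnder atTop fun n : ℕ => Φ n x) ⁻¹' unstableEquilibria X Φ D) := by
    ext x
    constructor
    · rintro ⟨hx, e, he, hlim⟩
      exact ⟨⟨x, hx⟩, ⟨⟨e, hlim⟩, by simpa [hlim.limUnder_eq] using he⟩, rfl⟩
    · rintro ⟨⟨x, hx⟩, ⟨⟨c, hc⟩, hlim⟩, rfl⟩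
      rw [mem_preimage, Tendsto.limUnder_eq hc] at hlim
      exact ⟨hx, c, hlim, hc⟩
  rw [h3]
  exact hX.subtype_image (h1.inter (h2 (measurableSet_unstableEquilibria hX hflow hD)))

/-- A subset of a second countable space all of whose points are isolated in it is countable. -/
lemma Set.countable_of_forall_eventually_notMem {α : Type*} [TopologicalSpace α]
    [SecondCountableTopology α] {s : Set α} (h : ∀ x ∈ s, ∀ᶠ y in 𝓝[≠] x, y ∉ s) :
    s.Countable := by
  have : DiscreteTopology s := by
    rw [discreteTopology_subtype_iff]
    intro x hx
    rw [← empty_mem_iff_bot]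
    filter_upwards [mem_inf_of_left (h x hx), mem_inf_of_right (mem_principal_self s)] with y h1 h2
      using h1 h2
  exact (Set.countable_coe_iff).1 (TopologicalSpace.separableSpace_iff_countable.1 inferInstance)

/-- The uniform measure on the segment from `0` to `v` witnesses that a Borel set meeting every line
in the direction `v` in a countable set is shy. -/
lemma isShy_of_countable_lines [MeasurableSpace E] [BorelSpace E] {W S : Set E} (hWS : W ⊆ S)
    (hS : MeasurableSet S) (v : E) (hv : ∀ x : E, {τ : ℝ | x + τ • v ∈ S}.Countable) :
    IsShy W := by
  have hc : Continuous fun τ : ℝ => τ • v := by fun_prop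
  refine ⟨S, hWS, hS, (volume.restrict (Icc (0 : ℝ) 1)).map fun τ => τ • v, inferInstance,
    fun h0 => ?_, ⟨(fun τ : ℝ => τ • v) '' Icc 0 1, isCompact_Icc.image hc, ?_⟩, fun x => ?_⟩
  · have h1 := congrArg (fun μ : Measure E => μ univ) h0
    simp [Measure.map_apply hc.measurable MeasurableSet.univ] at h1
  · rw [Measure.map_apply hc.measurable (isCompact_Icc.image hc).measurableSet.compl,
      Measure.restrict_apply' measurableSet_Icc]
    convert measure_empty (μ := (volume : Measure ℝ))
    rw [← disjoint_iff_inter_eq_empty]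
    exact disjoint_left.2 fun τ h1 h2 => h1 (mem_image_of_mem _ h2)
  · have h1 : (fun w => w + x) '' S = (fun w => w - x) ⁻¹' S := by
      ext w
      constructor
      · rintro ⟨y, hy, rfl⟩; simpa using hy
      · intro hw; exact ⟨w - x, hw, by simp⟩
    have h2 : MeasurableSet ((fun w => w - x) ⁻¹' S) := (measurable_id.sub_const x) hS
    rw [h1, Measure.map_apply hc.measurable h2]
    refine le_antisymm ((Measure.restrict_apply_le _ _).trans (le_of_eq ?_)) zero_le
    have h3 : (fun τ : ℝ => τ • v) ⁻¹' ((fun w => w - x) ⁻¹' S) = {τ : ℝ | -x + τ • v ∈ S} := by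
      ext τ
      simp [sub_eq_neg_add]
    rw [h3]
    exact (hv (-x)).measure_zero volume

end

open scoped Pointwise in
lemma smul_mem_interior_Ici {E : Type*} [NormedAddCommGroup E] [NormedSpace ℝ E] [PartialOrder E]
    [PosSMulMono ℝ E] {v : E} (hv : v ∈ interior (Ici (0 : E))) {c : ℝ} (hc : 0 < c) :
    c • v ∈ interior (Ici (0 : E)) := by
  have h1 : c • v ∈ c • interior (Ici (0 : E)) := smul_mem_smul_set hv
  rw [← interior_smul₀ hc.ne'] at h1
  refine interior_mono ?_ h1
  rintro _ ⟨y, hy, rfl⟩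
  exact smul_nonneg hc.le hy

/-- A line in the direction of an interior point `v ≠ 0` of the cone contains only countably many
points of the unstable basin. The limits of these points form a chain; at most three points have the
same limit; and the chain is countable, since its irreducible points are isolated in it. -/
lemma countable_line_inter_unstableBasin {E : Type*} [NormedAddCommGroup E] [NormedSpace ℝ E]
    [SecondCountableTopology E]
    [PartialOrder E] [IsOrderedAddMonoid E] [PosSMulMono ℝ E] [OrderClosedTopology E]
    {X : Set E} (hXpc : IsPConvex X) (hXint : X ⊆ closure (interior X))
    {Φ : ℝ → E → E} (hflow : IsSemiflowOn X Φ) (hsop : IsSOP X Φ)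
    {t₀ : ℝ} (ht₀ : 0 ≤ t₀) (hcompact : IsCompactMapOn X (Φ t₀))
    {D : ℝ → E → E →L[ℝ] E} (hderiv : ∀ t : ℝ, t₀ ≤ t → HasC1DerivOn X (Φ t) (D t))
    (hDcompact : ∀ x ∈ X, IsCompactOperator (D t₀ x)) (hP : PropertyP X Φ t₀ D)
    {v : E} (hv : v ∈ interior (Ici (0 : E))) (hv0 : v ≠ 0) (x : E) :
    {τ : ℝ | x + τ • v ∈ unstableBasin X Φ (D t₀)}.Countable := by
  set Z := {τ : ℝ | x + τ • v ∈ unstableBasin X Φ (D t₀)} with hZ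
  have hZX : ∀ τ ∈ Z, x + τ • v ∈ X := fun τ hτ => hτ.1
  have hZe : ∀ τ ∈ Z, ∃ e ∈ unstableEquilibria X Φ (D t₀),
      Tendsto (fun t => Φ t (x + τ • v)) atTop (𝓝 e) := by
    rintro τ ⟨hτX, e, he, hlim⟩
    exact ⟨e, he, hflow.tendsto_of_tendsto_nat hτX he.1 hlim⟩
  choose! g hgE hg using hZe
  have hcone : ∀ {α β : ℝ}, α < β → ConeLT (x + α • v) (x + β • v) := by
    intro α β hαβ
    have e1 : (x + β • v) - (x + α • v) = (β - α) • v := by module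
    rw [ConeLT, e1]
    exact smul_mem_interior_Ici hv (sub_pos.2 hαβ)
  have hgmono : ∀ α ∈ Z, ∀ β ∈ Z, α ≤ β → g α ≤ g β := by
    intro α hα β hβ hαβ
    rcases hαβ.eq_or_lt with rfl | hlt
    · exact le_rfl
    refine le_of_tendsto_of_tendsto (hg α hα) (hg β hβ) ?_
    filter_upwards [eventually_ge_atTop 0] with t ht
    exact hsop.monotone _ (hZX α hα) _ (hZX β hβ) (sub_nonneg.1 (interior_subset (hcone hlt))) t ht
  have hchain : ∀ a ∈ g '' Z, ∀ b ∈ g '' Z, a ≤ b ∨ b ≤ a := by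
    rintro _ ⟨α, hα, rfl⟩ _ ⟨β, hβ, rfl⟩
    rcases le_total α β with h | h
    · exact Or.inl (hgmono α hα β hβ h)
    · exact Or.inr (hgmono β hβ α hα h)
  have hsub : g '' Z ⊆ equilibria X Φ := by
    rintro _ ⟨α, hα, rfl⟩; exact (hgE α hα).1
  have hcount : (g '' Z).Countable := by
    have h1 := hP (g '' Z) hsub fun a ha b hb _ => hchain a ha b hb
    have h2 : {e ∈ g '' Z | IsIrreducibleAt t₀ D e}.Countable := by
      refine Set.countable_of_forall_eventually_notMem ?_
      rintro e ⟨he, hirr⟩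
      have hρ : 1 < opSpectralRadius (D t₀ e) := by
        obtain ⟨α, hα, rfl⟩ := he
        exact (hgE α hα).2
      filter_upwards [eventually_not_comparable hXint hsop ht₀ hderiv (hsub he)
        (hDcompact e (hsub he).1) hirr hρ] with y hy hyZ
      exact hy (hsub hyZ.1) (hchain e he y hyZ.1)
    refine (h1.union h2).mono fun e he => ?_
    by_cases hirr : IsIrreducibleAt t₀ D e
    · exact Or.inr ⟨he, hirr⟩
    · exact Or.inl ⟨he, hirr⟩
  have hfiber : ∀ e ∈ g '' Z, {τ ∈ Z | g τ = e}.Finite := by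
    intro e he
    by_contra hinf
    obtain ⟨s, hs, hcard⟩ := Set.Infinite.exists_subset_card_eq hinf 4
    let o := s.orderEmbOfFin hcard
    have ho : ∀ i, o i ∈ Z ∧ g (o i) = e := fun i => hs (s.orderEmbOfFin_mem hcard i)
    have hρ : 1 < opSpectralRadius (D t₀ e) := by
      rw [← (ho 0).2]; exact (hgE _ (ho 0).1).2
    have hoe : ∀ i, Tendsto (fun t => Φ t (x + o i • v)) atTop (𝓝 e) := fun i => by
      rw [← (ho i).2]; exact hg _ (ho i).1
    have hmid : ∀ i, 0 < i → i < 3 → x + o i • v = e := fun i h0 h3 =>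
      eq_of_coneLT_of_coneLT_of_tendsto ⟨v, hv⟩ hXpc hXint hflow hsop ht₀ hcompact
        (hderiv t₀ le_rfl) (hsub he) (hDcompact e (hsub he).1) hρ
        (hZX _ (ho 0).1) (hZX _ (ho i).1) (hZX _ (ho 3).1) (hcone (o.strictMono h0))
        (hcone (o.strictMono h3)) (hoe 0) (hoe i) (hoe 3)
    have h12 := (hmid 1 (by decide) (by decide)).trans (hmid 2 (by decide) (by decide)).symm
    have h12' : o 1 = o 2 := smul_left_injective ℝ hv0 (add_left_cancel h12)
    exact absurd (o.injective h12') (by decide)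
  refine (hcount.biUnion fun e he => (hfiber e he).countable).mono fun τ hτ => ?_
  exact mem_biUnion (mem_image_of_mem g hτ) ⟨hτ, rfl⟩

theorem mainTheorem3 {E : Type*} [NormedAddCommGroup E] [NormedSpace ℝ E] [CompleteSpace E]
    [TopologicalSpace.SeparableSpace E] [MeasurableSpace E] [BorelSpace E]
    [PartialOrder E] [IsOrderedAddMonoid E] [PosSMulMono ℝ E] [OrderClosedTopology E]
    (hcone : (interior (Ici (0 : E))).Nonempty)
    (X : Set E) (hXpc : IsPConvex X) (hXborel : MeasurableSet X)
    (hXint : X ⊆ closure (interior X))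
    (Φ : ℝ → E → E) (hflow : IsSemiflowOn X Φ) (hsop : IsSOP X Φ)
    (t₀ : ℝ) (ht₀ : 0 ≤ t₀)
    (hcompact : ∀ t : ℝ, t₀ ≤ t → IsCompactMapOn X (Φ t))
    (D : ℝ → E → E →L[ℝ] E)
    (hderiv : ∀ t : ℝ, t₀ ≤ t → HasC1DerivOn X (Φ t) (D t))
    (hDcompact : ∀ t : ℝ, t₀ ≤ t → ∀ x ∈ X, IsCompactOperator (D t x))
    (hP : PropertyP X Φ t₀ D) :
    IsPrevalentIn (stablyConvergentPoints X Φ t₀ D) (convergentPoints X Φ) := by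
  have : SecondCountableTopology E := UniformSpace.secondCountable_of_separable E
  obtain ⟨v, hv⟩ := hcone
  refine isShy_of_countable_lines (S := unstableBasin X Φ (D t₀)) ?_
    (measurableSet_unstableBasin hXborel hflow (hderiv t₀ le_rfl).continuousOn) v fun x => ?_
  · rintro x ⟨⟨hx, e, he, hω⟩, hxs⟩
    have hρ : 1 < opSpectralRadius (D t₀ e) := by
      by_contra! hle
      exact hxs ⟨hx, e, ⟨he, hle⟩, hω⟩
    exact ⟨hx, e, ⟨he, hρ⟩, (hflow.tendsto_of_omegaSet_eq ht₀ (hcompact t₀ le_rfl) hx he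
      hω).comp tendsto_natCast_atTop_atTop⟩
  · rcases eq_or_ne v 0 with rfl | hv0
    · -- The cone of a nonzero space does not have `0` in its interior.
      convert countable_empty (α := ℝ)
      ext τ
      simp only [mem_ofPred_eq, mem_empty_iff_false, iff_false]
      rintro ⟨-, e, ⟨he, hρ⟩, -⟩
      have hle := opSpectralRadius_le_of_growth (hDcompact t₀ le_rfl e he.1)
        (fun z hz => (hderiv t₀ le_rfl).apply_nonneg hXint
          (fun a ha b hb hab => hsop.monotone a ha b hb hab t₀ ht₀) he.1 hz) hv le_rfl (C := 0)
        (fun n => by simp)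
      exact absurd hle (not_le.2 hρ)
    · exact countable_line_inter_unstableBasin hXpc hXint hflow hsop ht₀ (hcompact t₀ le_rfl)
        hderiv (hDcompact t₀ le_rfl) hP hv hv0 x
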